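/- Write $\langle y\rangle=(1+|y|^2)^{1/2}$ and $D=-i\nabla$ on $\mathbb R^2$; $\langle D\rangle^s$ and $e^{i\tau\langle D\rangle}$ are the Fourier multipliers with symbols $\langle\xi\rangle^s$ and $e^{i\tau\langle\xi\rangle}$, acting on $\mathbb C^2$-valued tempered distributions. Put $\|u\|_{H^s}=\|\langle D\rangle^su\|_{L^2}$, $\|u\|_{W^{k,\infty}}=\|\langle D\rangle^ku\|_{L^\infty}$ (equal to $+\infty$ when the distribution under the norm is not a function in the space), and $\|xu\|_{H^5}=\big(\sum_{j=1}^2\|x_ju\|_{H^5}^2\big)^{1/2}$. Let $$\gamma^0=\begin{pmatrix}1&0\\0&-1\end{pmatrix},\quad\gamma^1=\begin{pmatrix}0&1\\-1&0\end{pmatrix},\quad\gamma^2=\begin{pmatrix}0&-i\\-i&0\end{pmatrix},\qquad \alpha^j=\gamma^0\gamma^j,\quad\beta=\gamma^0,$$ and, for $\theta\in\{+,-\}$, $\Pi_\theta(D)=\frac12\big(I+\theta\langle D\rangle^{-1}[\alpha\cdot D+\beta]\big)$. For a family $\psi(t)$, $t\in[0,T]$, of $\mathbb C^2$-valued tempered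 distributions on $\mathbb R^2$ put $\psi_\theta=\Pi_\theta(D)\psi$ and $$\|\psi\|_{\Sigma_T}=\sum_{\theta\in\{+,-\}}\ \sup_{t\in[0,T]}\Big(\|\psi_\theta(t)\|_{H^s}+\|x\,e^{\theta it\langle D\rangle}\psi_\theta(t)\|_{H^5}\Big).$$ Proposition. Let $s\ge50$ and $K>0$. There is a constant $C>0$, depending only on $s$ and $K$, such that for all $T\ge0$, all $\varepsilon_1>0$ and all $\psi$ satisfying the a priori assumption $\|\psi\|_{\Sigma_T}\le K\varepsilon_1$, $$\|\psi(t)\|_{W^{k,\infty}}\le C\,\varepsilon_1\,\langle t\rangle^{-3/4}\qquad\text{for all }t\in[0,T]\text{ and all real }0\le k\le7.$$ -/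

import Mathlib

open MeasureTheory FourierTransform TemperedDistribution
open scoped ENNReal SchwartzMap LineDeriv

noncomputable section

/-- The physical space `ℝ²`. -/
abbrev Plane : Type := EuclideanSpace ℝ (Fin 2)

/-- The space `ℂ²` in which spinors take their values. -/
abbrev Spinor : Type := EuclideanSpace ℂ (Fin 2)

/-- The Japanese bracket `⟨y⟩ = (1 + |y|²)^{1/2}`. -/
def japaneseBracket {V : Type*} [NormedAddCommGroup V] (y : V) : ℝ :=
  (1 + ‖y‖ ^ 2) ^ (1 / 2 : ℝ)

theorem japaneseBracket_pos {V : Type*} [NormedAddCommGroup V] (y : V) :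
    0 < japaneseBracket y := by
  unfold japaneseBracket; positivity

/-- Mathlib's Fourier transform is `∫ exp (-2πi x·ξ) u(x) dx`, so that `D = -i∇` has the symbol
`2πξ`. This is the symbol `⟨2πξ⟩^s` of `⟨D⟩^s`. -/
def bracketSymbol (s : ℝ) (ξ : Plane) : ℂ :=
  ((japaneseBracket ((2 * Real.pi) • ξ) ^ s : ℝ) : ℂ)

/-- The symbol `exp (iτ⟨2πξ⟩)` of `exp (iτ⟨D⟩)`. -/
def propagatorSymbol (τ : ℝ) (ξ : Plane) : ℂ :=
  Complex.exp (((τ * japaneseBracket ((2 * Real.pi) • ξ) : ℝ) : ℂ) * Complex.I)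

theorem hasTemperateGrowth_realBracketSymbol (s : ℝ) :
    (fun ξ : Plane => japaneseBracket ((2 * Real.pi) • ξ) ^ s).HasTemperateGrowth := by
  have h1 : (fun x : Plane => (1 + ‖x‖ ^ 2) ^ (s / 2)).HasTemperateGrowth := by fun_prop
  have h2 : (fun ξ : Plane => (2 * Real.pi) • ξ).HasTemperateGrowth :=
    ((2 * Real.pi) • ContinuousLinearMap.id ℝ Plane).hasTemperateGrowth
  have h3 := h1.comp h2
  convert h3 using 1
  ext ξ
  simp only [japaneseBracket, Function.comp]
  rw [← Real.rpow_mul (by positivity)]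
  congr 1
  ring

theorem hasTemperateGrowth_bracketSymbol (s : ℝ) : (bracketSymbol s).HasTemperateGrowth :=
  Function.Complex.hasTemperateGrowth_ofReal.comp (hasTemperateGrowth_realBracketSymbol s)

theorem hasTemperateGrowth_propagatorSymbol (τ : ℝ) :
    (propagatorSymbol τ).HasTemperateGrowth := by
  have h1 : (fun r : ℝ => Complex.exp ((r : ℂ) * Complex.I)).HasTemperateGrowth := by
    have hd : ∀ r : ℝ, HasDerivAt (fun r : ℝ => Complex.exp ((r : ℂ) * Complex.I))
        (Complex.I * Complex.exp ((r : ℂ) * Complex.I)) r := by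
      intro r
      have := ((Complex.ofRealCLM.hasDerivAt (x := r)).mul_const Complex.I).cexp
      simpa [mul_comm] using this
    have hn : ∀ n : ℕ, iteratedDeriv n (fun r : ℝ => Complex.exp ((r : ℂ) * Complex.I)) =
        fun r : ℝ => Complex.I ^ n * Complex.exp ((r : ℂ) * Complex.I) := by
      intro n
      induction n with
      | zero => ext r; simp
      | succ n ih =>
        rw [iteratedDeriv_succ, ih]
        ext r
        rw [((hd r).const_mul _).deriv]
        ring
    refine ⟨?_, fun n => ⟨0, 1, fun r => ?_⟩⟩
    · exact (Complex.ofRealCLM.contDiff.mul contDiff_const).cexp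
    · rw [norm_iteratedFDeriv_eq_norm_iteratedDeriv, hn]
      simp [Complex.norm_exp]
  have h2 : (fun ξ : Plane => τ * japaneseBracket ((2 * Real.pi) • ξ)).HasTemperateGrowth := by
    have h := (Function.HasTemperateGrowth.const τ).mul (hasTemperateGrowth_realBracketSymbol 1)
    simpa [Pi.mul_def] using h
  exact h1.comp h2

/-- `⟨D⟩^s`, acting on `ℂ²`-valued tempered distributions on `ℝ²`. -/
def bracketD (s : ℝ) : 𝓢'(Plane, Spinor) →L[ℂ] 𝓢'(Plane, Spinor) :=
  fourierMultiplierCLM Spinor (bracketSymbol s)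

/-- The half-Klein-Gordon group `exp (iτ⟨D⟩)`, acting on `ℂ²`-valued tempered distributions. -/
def kgPropagator (τ : ℝ) : 𝓢'(Plane, Spinor) →L[ℂ] 𝓢'(Plane, Spinor) :=
  fourierMultiplierCLM Spinor (propagatorSymbol τ)

/-- Multiplication by the coordinate function `x_j`. -/
def mulCoord (j : Fin 2) : 𝓢'(Plane, Spinor) →L[ℂ] 𝓢'(Plane, Spinor) :=
  smulLeftCLM Spinor (fun x : Plane => ((x j : ℝ) : ℂ))

theorem hasTemperateGrowth_coord (j : Fin 2) :
    (fun x : Plane => ((x j : ℝ) : ℂ)).HasTemperateGrowth :=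
  Function.Complex.hasTemperateGrowth_ofReal.comp
    (EuclideanSpace.proj j : Plane →L[ℝ] ℝ).hasTemperateGrowth

/-- `D_j = -i ∂_j`. -/
def opD (j : Fin 2) (u : 𝓢'(Plane, Spinor)) : 𝓢'(Plane, Spinor) :=
  (-Complex.I) • ∂_{EuclideanSpace.single j (1 : ℝ)} u

/-- The Dirac matrices `γ⁰, γ¹, γ²`. -/
def gammaMatrix : Fin 3 → Matrix (Fin 2) (Fin 2) ℂ :=
  ![!![1, 0; 0, -1], !![0, 1; -1, 0], !![0, -Complex.I; -Complex.I, 0]]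

/-- `α^μ = γ⁰ γ^μ`. -/
def alphaMatrix (μ : Fin 3) : Matrix (Fin 2) (Fin 2) ℂ := gammaMatrix 0 * gammaMatrix μ

/-- The pointwise action of a constant matrix on `ℂ²`-valued tempered distributions. -/
def matrixAct (A : Matrix (Fin 2) (Fin 2) ℂ) (u : 𝓢'(Plane, Spinor)) : 𝓢'(Plane, Spinor) :=
  PointwiseConvergenceCLM.postcomp _ (Matrix.toEuclideanCLM (𝕜 := ℂ) A) u

/-- The Dirac operator `α · D + β`, with `β = γ⁰` (and mass one). -/
def diracOp (u : 𝓢'(Plane, Spinor)) : 𝓢'(Plane, Spinor) :=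
  matrixAct (alphaMatrix 1) (opD 0 u) + matrixAct (alphaMatrix 2) (opD 1 u)
    + matrixAct (gammaMatrix 0) u

/-- The projection `Π_θ(D) = ½ (I + θ ⟨D⟩⁻¹ (α · D + β))`, for a sign `θ = ±1`. -/
def diracProj (θ : ℝ) (u : 𝓢'(Plane, Spinor)) : 𝓢'(Plane, Spinor) :=
  (1 / 2 : ℂ) • (u + (θ : ℂ) • bracketD (-1) (diracOp u))

/-- `‖u‖_{W^{s,p}} = ‖⟨D⟩^s u‖_{L^p}`; it is `∞` if `⟨D⟩^s u` is not (represented by) a function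
in `L^p`, and otherwise the norm of the unique such function. -/
def sobolevNorm (s : ℝ) (p : ℝ≥0∞) [Fact (1 ≤ p)] (u : 𝓢'(Plane, Spinor)) : ℝ≥0∞ :=
  ⨅ (v : Lp Spinor p (volume : Measure Plane)) (_ : bracketD s u = (v : 𝓢'(Plane, Spinor))), ‖v‖ₑ

/-- `‖x u‖_{H^s}`, where `x u` is the pair `(x₁ u, x₂ u)`. -/
def weightedSobolevNorm (s : ℝ) (u : 𝓢'(Plane, Spinor)) : ℝ≥0∞ :=
  (∑ j : Fin 2, sobolevNorm s 2 (mulCoord j u) ^ 2) ^ (1 / 2 : ℝ)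

/-- `‖ψ_θ‖_{Σ_T^θ} = sup_{t ∈ [0,T]} (‖ψ_θ(t)‖_{H^s} + ‖x exp (θit⟨D⟩) ψ_θ(t)‖_{H^5})`. -/
def signedSigmaNorm (s θ T : ℝ) (ψθ : ℝ → 𝓢'(Plane, Spinor)) : ℝ≥0∞ :=
  ⨆ t ∈ Set.Icc (0 : ℝ) T,
    (sobolevNorm s 2 (ψθ t) + weightedSobolevNorm 5 (kgPropagator (θ * t) (ψθ t)))

/-- `‖ψ‖_{Σ_T} = ‖ψ_+‖_{Σ_T^+} + ‖ψ_-‖_{Σ_T^-}` with `ψ_± = Π_±(D) ψ`. -/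
def sigmaNorm (s T : ℝ) (ψ : ℝ → 𝓢'(Plane, Spinor)) : ℝ≥0∞ :=
  signedSigmaNorm s 1 T (fun t => diracProj 1 (ψ t))
    + signedSigmaNorm s (-1) T (fun t => diracProj (-1) (ψ t))

end

/-! Fix `t` and a sign `θ`, put `σ = θt` and `u = ψ_θ(t)`. With `V = 𝓕(⟨D⟩^s u)`, the value of
`⟨D⟩^k u` at `x` is the integral of `planeWave x · freq^(k-s) · V`. It must be bounded by
`|σ|^(-3/4)` when `|σ| ≥ 1`; for smaller `|σ|` Cauchy-Schwarz is enough.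

Frequencies are separated by the identity `1 = (1 - z)^36 + ∑ c_j z^(j+1)` with `z = exp(-η freq)`
and `η = |σ|^(-1/48)`. The first term is at most `(η freq)^36 = |σ|^(-3/4) freq^36`, and the surplus
regularity `s ≥ 50` pays for the powers of `freq`. The other terms carry a damping `exp(-2δ freq)`
with `δ ≥ η/2`. Being pure exponentials, they lead to an explicit kernel, so no stationary phase is
needed.

Half of that damping joins the phase `exp(-iσ freq)` to form the symbol of `exp(-τ⟨D⟩)/⟨D⟩` with `τ
= δ + iσ`. Its kernel is `exp(-z)/(2πz)` with `z² = |y|² + τ²`: subordination to Gaussians gives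
this for real `τ`, analytic continuation for `Re τ > 0` (`fourier_poissonSymbol`). Since `Re z · Im
z = δσ`, the kernel is at most `1/(δ|σ|)` everywhere (`norm_fourier_poissonSymbol_le`).

The kernel is then paired with the profile `exp(iσ⟨D⟩)u`, for which one power of `x` is controlled
in `H^5`. By duality only the `L²` norm of kernel`/⟨y⟩` matters
(`norm_integral_mul_fourier_smul_le`). As `⟨y⟩⁻¹` narrowly fails to be in `L²(ℝ²)`, the sup bound is
interpolated with a Plancherel bound, which gives `(δ|σ|)^(-7/8)` up to a power of `1/δ`
(`decayNorm_fourierInv_wavePoisson_le`). The distance from `7/8` to `3/4` absorbs all powers of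
`1/δ` (`lowFreq_rate_le`). -/

noncomputable section

/-! ### Gaussian subordination integrals on the half-line. -/

section SubordinationIntegral

open Set

variable {a c : ℝ}

theorem image_mul_sub_div_Ioi (ha : 0 < a) (hc : 0 < c) :
    (fun u : ℝ => a * u - c / u) '' Ioi 0 = univ := by
  refine eq_univ_of_forall fun p => ?_
  have h0 : 0 < p ^ 2 + 4 * a * c := by positivity
  have hs : Real.sqrt (p ^ 2 + 4 * a * c) ^ 2 = p ^ 2 + 4 * a * c := Real.sq_sqrt h0.le
  have h1 : |p| < Real.sqrt (p ^ 2 + 4 * a * c) := by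
    rw [← Real.sqrt_sq_eq_abs]
    exact Real.sqrt_lt_sqrt (sq_nonneg p) (by nlinarith [mul_pos ha hc])
  have h2 : 0 < p + Real.sqrt (p ^ 2 + 4 * a * c) := by
    linarith [neg_abs_le p]
  -- The positive root of `a u² - p u - c = 0`.
  refine ⟨(p + Real.sqrt (p ^ 2 + 4 * a * c)) / (2 * a), ?_, ?_⟩
  · simp only [mem_Ioi]; positivity
  · simp only
    generalize Real.sqrt (p ^ 2 + 4 * a * c) = r at *
    field_simp
    nlinarith

theorem injOn_mul_sub_div_Ioi (ha : 0 < a) (hc : 0 < c) :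
    InjOn (fun u : ℝ => a * u - c / u) (Ioi 0) := by
  have : StrictMonoOn (fun u : ℝ => a * u - c / u) (Ioi 0) := by
    intro u hu v hv huv
    simp only [mem_Ioi] at hu hv
    have h1 : a * u < a * v := by gcongr
    have h2 : c / v < c / u := by gcongr
    simp only
    linarith
  exact this.injOn

theorem hasDerivAt_mul_sub_div {u : ℝ} (hu : 0 < u) :
    HasDerivAt (fun u : ℝ => a * u - c / u) (a + c / u ^ 2) u := by
  simp only [div_eq_mul_inv]
  exact (((hasDerivAt_id' u).const_mul a).sub ((hasDerivAt_inv hu.ne').const_mul c)).congr_deriv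
    (by ring)

/-- The substitution `p = au - c/u` turns the Gaussian integral over the line into the integral with
weight `a + c/u²`. The inversion `u ↦ c/(au)` fixes the exponential and exchanges the two summands
of the weight, so each contributes exactly half of `√π`. -/
theorem exp_neg_mul_sub_div_sq_integrals (ha : 0 < a) (hc : 0 < c) :
    IntegrableOn (fun u : ℝ => Real.exp (-(a * u - c / u) ^ 2)) (Ioi 0) ∧
    IntegrableOn (fun u : ℝ => c / u ^ 2 * Real.exp (-(a * u - c / u) ^ 2)) (Ioi 0) ∧
    ∫ u in Ioi (0 : ℝ), Real.exp (-(a * u - c / u) ^ 2) = Real.sqrt Real.pi / (2 * a) ∧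
    ∫ u in Ioi (0 : ℝ), c / u ^ 2 * Real.exp (-(a * u - c / u) ^ 2) = Real.sqrt Real.pi / 2 := by
  set E : ℝ → ℝ := fun u => Real.exp (-(a * u - c / u) ^ 2) with hE
  have hder : ∀ u ∈ Ioi (0 : ℝ),
      HasDerivWithinAt (fun u : ℝ => a * u - c / u) (a + c / u ^ 2) (Ioi 0) u :=
    fun u hu => (hasDerivAt_mul_sub_div hu).hasDerivWithinAt
  have habs : ∀ u ∈ Ioi (0 : ℝ), |a + c / u ^ 2| • E u = (a + c / u ^ 2) * E u := by
    intro u hu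
    have : 0 < a + c / u ^ 2 := by have : (0 : ℝ) < u := hu; positivity
    rw [abs_of_pos this, smul_eq_mul]
  have hsumint : IntegrableOn (fun u => (a + c / u ^ 2) * E u) (Ioi 0) := by
    have h := (integrableOn_image_iff_integrableOn_abs_deriv_smul measurableSet_Ioi hder
      (injOn_mul_sub_div_Ioi ha hc) (fun p => Real.exp (-p ^ 2))).1 (by
        rw [image_mul_sub_div_Ioi ha hc, integrableOn_univ]
        simpa using integrable_exp_neg_mul_sq (b := 1) one_pos)
    exact h.congr_fun habs measurableSet_Ioi
  have hsum : ∫ u in Ioi (0 : ℝ), (a + c / u ^ 2) * E u = Real.sqrt Real.pi := by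
    have h := integral_image_eq_integral_abs_deriv_smul measurableSet_Ioi hder
      (injOn_mul_sub_div_Ioi ha hc) (fun p => Real.exp (-p ^ 2))
    rw [image_mul_sub_div_Ioi ha hc, setIntegral_univ] at h
    rw [← setIntegral_congr_fun measurableSet_Ioi habs, ← h]
    simpa using integral_gaussian 1
  have hEmeas : Measurable E := by fun_prop
  have hEint : IntegrableOn E (Ioi 0) := by
    refine Integrable.mono' (hsumint.const_mul a⁻¹) hEmeas.aestronglyMeasurable ?_
    refine (ae_restrict_mem measurableSet_Ioi).mono fun u hu => ?_
    have hu' : (0 : ℝ) < u := hu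
    rw [Real.norm_of_nonneg (Real.exp_nonneg _), ← mul_assoc]
    refine le_mul_of_one_le_left (Real.exp_nonneg _) ?_
    rw [mul_add, inv_mul_cancel₀ ha.ne']
    have : 0 ≤ a⁻¹ * (c / u ^ 2) := by positivity
    linarith
  have hE2int : IntegrableOn (fun u => c / u ^ 2 * E u) (Ioi 0) := by
    have := hsumint.sub (hEint.const_mul a)
    refine this.congr_fun (fun u _ => ?_) measurableSet_Ioi
    simp only [Pi.sub_apply]
    ring
  have himg : (fun u : ℝ => c / a / u) '' Ioi 0 = Ioi 0 := by
    ext p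
    constructor
    · rintro ⟨u, hu, rfl⟩
      have hu' : (0 : ℝ) < u := hu
      simp only [mem_Ioi]; positivity
    · intro hp
      have hp' : (0 : ℝ) < p := hp
      refine ⟨c / a / p, by simp only [mem_Ioi]; positivity, ?_⟩
      simp only
      field_simp
  have hinv : ∫ u in Ioi (0 : ℝ), E u = ∫ u in Ioi (0 : ℝ), a⁻¹ * (c / u ^ 2 * E u) := by
    have h := integral_image_eq_integral_abs_deriv_smul (s := Ioi (0 : ℝ))
      (f := fun u : ℝ => c / a / u) (f' := fun u => c / a * (-(u ^ 2)⁻¹)) measurableSet_Ioi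
      (fun u hu => ((hasDerivAt_inv (ne_of_gt hu)).const_mul (c / a)).hasDerivWithinAt)
      (fun u hu v hv huv => by
        have hu' : (0 : ℝ) < u := hu
        have hv' : (0 : ℝ) < v := hv
        simp only at huv
        field_simp at huv
        linarith) E
    rw [himg] at h
    rw [h]
    refine setIntegral_congr_fun measurableSet_Ioi fun u hu => ?_
    have hu' : (0 : ℝ) < u := hu
    have h1 : |c / a * (-(u ^ 2)⁻¹)| = a⁻¹ * (c / u ^ 2) := by
      rw [mul_neg, abs_neg, abs_of_pos (by positivity)]
      field_simp
    have h2 : E (c / a / u) = E u := by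
      simp only [hE]
      congr 2
      rw [show a * (c / a / u) = c / u by field_simp, show c / (c / a / u) = a * u by field_simp]
      ring
    simp only [h1, h2, smul_eq_mul, mul_assoc]
  rw [integral_const_mul] at hinv
  have hsplit : ∫ u in Ioi (0 : ℝ), (a + c / u ^ 2) * E u =
      a * (∫ u in Ioi (0 : ℝ), E u) + ∫ u in Ioi (0 : ℝ), c / u ^ 2 * E u := by
    rw [← integral_const_mul, ← integral_add (hEint.const_mul a) hE2int]
    simp only [add_mul]
  have hkey : a * (∫ u in Ioi (0 : ℝ), E u) = ∫ u in Ioi (0 : ℝ), c / u ^ 2 * E u := by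
    rw [hinv]; field_simp
  refine ⟨hEint, hE2int, ?_, ?_⟩
  · field_simp; linarith
  · linarith

/-- The subordination formula for `exp (-ab) / a`. -/
theorem integral_exp_neg_sq_sub_div_sq {b : ℝ} (ha : 0 < a) (hb : 0 < b) :
    IntegrableOn (fun u : ℝ => Real.exp (-(a ^ 2 * u ^ 2) - b ^ 2 / (4 * u ^ 2))) (Ioi 0) ∧
    ∫ u in Ioi (0 : ℝ), Real.exp (-(a ^ 2 * u ^ 2) - b ^ 2 / (4 * u ^ 2)) =
      Real.sqrt Real.pi / 2 * (Real.exp (-(b * a)) / a) := by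
  have hc : 0 < b / 2 := by positivity
  obtain ⟨h1, -, h3, -⟩ := exp_neg_mul_sub_div_sq_integrals ha hc
  have hcongr : EqOn (fun u : ℝ => Real.exp (-(b * a)) * Real.exp (-(a * u - b / 2 / u) ^ 2))
      (fun u : ℝ => Real.exp (-(a ^ 2 * u ^ 2) - b ^ 2 / (4 * u ^ 2))) (Ioi 0) := by
    intro u hu
    have hu' : (0 : ℝ) < u := hu
    simp only
    rw [← Real.exp_add]
    congr 1
    field_simp
    ring
  have h1' : IntegrableOn
      (fun u : ℝ => Real.exp (-(b * a)) * Real.exp (-(a * u - b / 2 / u) ^ 2)) (Ioi 0) :=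
    h1.const_mul _
  refine ⟨h1'.congr_fun hcongr measurableSet_Ioi, ?_⟩
  rw [← setIntegral_congr_fun measurableSet_Ioi hcongr, integral_const_mul, h3]
  field_simp

theorem integral_inv_sq_mul_exp_neg_sq_sub_div_sq {b : ℝ} (hb : 0 < b) :
    ∫ u in Ioi (0 : ℝ), (u ^ 2)⁻¹ * Real.exp (-u ^ 2 - b ^ 2 / (4 * u ^ 2)) =
      Real.sqrt Real.pi * (Real.exp (-b) / b) := by
  have hc : 0 < b / 2 := by positivity
  obtain ⟨-, -, -, h4⟩ := exp_neg_mul_sub_div_sq_integrals one_pos hc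
  have hcongr : EqOn
      (fun u : ℝ => 2 / b * Real.exp (-b) * (b / 2 / u ^ 2 * Real.exp (-(1 * u - b / 2 / u) ^ 2)))
      (fun u : ℝ => (u ^ 2)⁻¹ * Real.exp (-u ^ 2 - b ^ 2 / (4 * u ^ 2))) (Ioi 0) := by
    intro u hu
    have hu' : (0 : ℝ) < u := hu
    have h : Real.exp (-u ^ 2 - b ^ 2 / (4 * u ^ 2)) =
        Real.exp (-b) * Real.exp (-(1 * u - b / 2 / u) ^ 2) := by
      rw [← Real.exp_add]
      congr 1
      field_simp
      ring
    simp only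
    rw [h]
    field_simp
  rw [← setIntegral_congr_fun measurableSet_Ioi hcongr, integral_const_mul, h4]
  field_simp

end SubordinationIntegral

/-! ### Elementary bounds and integrability for the frequency. -/

section Frequency

/-- The relativistic frequency `⟨2πξ⟩`. -/
def freq (ξ : Plane) : ℝ := japaneseBracket ((2 * Real.pi) • ξ)

theorem freq_pos (ξ : Plane) : 0 < freq ξ := japaneseBracket_pos _

theorem japaneseBracket_eq_sqrt {V : Type*} [NormedAddCommGroup V] (y : V) :
    japaneseBracket y = Real.sqrt (1 + ‖y‖ ^ 2) := by
  rw [japaneseBracket, Real.sqrt_eq_rpow]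

theorem freq_sq (ξ : Plane) : freq ξ ^ 2 = 1 + (2 * Real.pi) ^ 2 * ‖ξ‖ ^ 2 := by
  rw [freq, japaneseBracket_eq_sqrt, Real.sq_sqrt (by positivity), norm_smul, mul_pow,
    Real.norm_of_nonneg (by positivity)]

theorem one_le_freq (ξ : Plane) : 1 ≤ freq ξ := by
  have h := freq_sq ξ
  have h2 : 0 ≤ (2 * Real.pi) ^ 2 * ‖ξ‖ ^ 2 := by positivity
  nlinarith [freq_pos ξ]

theorem freq_hasTemperateGrowth : freq.HasTemperateGrowth := by
  have h := hasTemperateGrowth_realBracketSymbol 1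
  simp only [Real.rpow_one] at h
  exact h

theorem freq_rpow_hasTemperateGrowth (r : ℝ) : (fun ξ => freq ξ ^ r).HasTemperateGrowth :=
  hasTemperateGrowth_realBracketSymbol r

@[fun_prop]
theorem continuous_freq : Continuous freq := freq_hasTemperateGrowth.1.continuous

theorem integrable_freq_rpow {r : ℝ} (hr : 2 < r) :
    Integrable (fun ξ : Plane => freq ξ ^ (-r)) := by
  have h := (integrable_rpow_neg_one_add_norm_sq (E := Plane) (μ := volume) (r := r)
    (by simpa using hr)).comp_smul (R := 2 * Real.pi) (by positivity)
  refine h.congr (Filter.Eventually.of_forall fun ξ => ?_)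
  simp only [freq, japaneseBracket]
  rw [← Real.rpow_mul (by positivity)]
  congr 1
  ring

theorem exp_neg_le_factorial_div_pow {x : ℝ} (hx : 0 < x) (n : ℕ) :
    Real.exp (-x) ≤ n.factorial / x ^ n := by
  have h : x ^ n / n.factorial ≤ Real.exp x := Real.pow_div_factorial_le_exp x hx.le n
  rw [Real.exp_neg, ← inv_div]
  gcongr

theorem integrable_exp_neg_mul_freq {δ : ℝ} (hδ : 0 < δ) :
    Integrable (fun ξ : Plane => Real.exp (-(δ * freq ξ))) := by
  refine Integrable.mono' ((integrable_freq_rpow (r := 3) (by norm_num)).const_mul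
    ((Nat.factorial 3 : ℝ) / δ ^ 3)) (by fun_prop) (Filter.Eventually.of_forall fun ξ => ?_)
  have hf := freq_pos ξ
  rw [Real.norm_of_nonneg (Real.exp_nonneg _)]
  refine (exp_neg_le_factorial_div_pow (mul_pos hδ hf) 3).trans (le_of_eq ?_)
  rw [show (-3 : ℝ) = -((3 : ℕ) : ℝ) by norm_num, Real.rpow_neg hf.le, Real.rpow_natCast]
  field_simp

end Frequency

/-! ### The kernel of `exp(-τ⟨D⟩)/⟨D⟩` for real `τ`. -/

section Kernel

open Set

/-- The symbol `exp (-τ⟨2πξ⟩) / ⟨2πξ⟩`. -/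
def poissonSymbol (τ : ℂ) (ξ : Plane) : ℂ := Complex.exp (-(τ * freq ξ)) / freq ξ

theorem norm_poissonSymbol (τ : ℂ) (ξ : Plane) :
    ‖poissonSymbol τ ξ‖ = Real.exp (-(τ.re * freq ξ)) / freq ξ := by
  rw [poissonSymbol, norm_div, Complex.norm_exp, Complex.norm_real,
    Real.norm_of_nonneg (freq_pos ξ).le]
  simp

theorem continuous_poissonSymbol (τ : ℂ) : Continuous (poissonSymbol τ) := by
  unfold poissonSymbol
  refine Continuous.div (by fun_prop) (by fun_prop) fun ξ => ?_
  exact_mod_cast (freq_pos ξ).ne'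

theorem integrable_poissonSymbol {τ : ℂ} (hτ : 0 < τ.re) : Integrable (poissonSymbol τ) := by
  refine Integrable.mono' (integrable_exp_neg_mul_freq hτ)
    (continuous_poissonSymbol τ).aestronglyMeasurable (Filter.Eventually.of_forall fun ξ => ?_)
  rw [norm_poissonSymbol]
  exact div_le_self (Real.exp_nonneg _) (one_le_freq ξ)

theorem fourier_gaussian_plane {u : ℝ} (hu : 0 < u) (y : Plane) :
    ∫ ξ : Plane, Real.fourierChar (-inner ℝ ξ y) •
      ((Real.exp (-((2 * Real.pi * u) ^ 2 * ‖ξ‖ ^ 2)) : ℝ) : ℂ) =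
      ((1 / (4 * Real.pi * u ^ 2) * Real.exp (-‖y‖ ^ 2 / (4 * u ^ 2)) : ℝ) : ℂ) := by
  have hb : 0 < (((2 * Real.pi * u) ^ 2 : ℝ) : ℂ).re := by
    rw [Complex.ofReal_re]; positivity
  have h := fourier_gaussian_innerProductSpace (V := Plane) hb y
  rw [Real.fourier_eq] at h
  have hpi : (Real.pi : ℂ) ≠ 0 := by exact_mod_cast Real.pi_ne_zero
  have hu' : (u : ℂ) ≠ 0 := by exact_mod_cast hu.ne'
  convert h using 1
  · push_cast
    congr with ξ
    congr 2
    ring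
  · push_cast
    simp only [finrank_euclideanSpace, Fintype.card_fin]
    norm_num
    congr 1
    · field_simp
      norm_num
    · congr 1
      field_simp
      norm_num

/-- Subordination writes the symbol as a superposition of Gaussians in `ξ`. After Fubini each
Gaussian is transformed explicitly; in dimension two this produces the factor `u⁻²` and merges `τ²`
with `‖y‖²`, so a second subordination integral, now with parameter `B`, finishes the computation.
-/
theorem fourier_poissonSymbol_of_real {τ : ℝ} (hτ : 0 < τ) (y : Plane) :
    𝓕 (poissonSymbol τ) y =
      ((Real.exp (-Real.sqrt (‖y‖ ^ 2 + τ ^ 2)) /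
        (2 * Real.pi * Real.sqrt (‖y‖ ^ 2 + τ ^ 2)) : ℝ) : ℂ) := by
  set B := Real.sqrt (‖y‖ ^ 2 + τ ^ 2) with hB
  have hBpos : 0 < B := Real.sqrt_pos.2 (by positivity)
  have hBsq : B ^ 2 = ‖y‖ ^ 2 + τ ^ 2 := Real.sq_sqrt (by positivity)
  have hpi : 0 < Real.sqrt Real.pi := Real.sqrt_pos.2 Real.pi_pos
  set G : Plane → ℝ → ℝ := fun ξ u =>
    Real.exp (-(freq ξ ^ 2 * u ^ 2) - τ ^ 2 / (4 * u ^ 2)) with hG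
  set H : Plane → ℝ → ℂ := fun ξ u => Real.fourierChar (-inner ℝ ξ y) • ((G ξ u : ℝ) : ℂ) with hH
  have hGint : ∀ ξ, IntegrableOn (G ξ) (Ioi 0) := fun ξ =>
    (integral_exp_neg_sq_sub_div_sq (freq_pos ξ) hτ).1
  have hGval : ∀ ξ, ∫ u in Ioi (0 : ℝ), G ξ u =
      Real.sqrt Real.pi / 2 * (Real.exp (-(τ * freq ξ)) / freq ξ) := fun ξ =>
    (integral_exp_neg_sq_sub_div_sq (freq_pos ξ) hτ).2
  have hnorm : ∀ ξ u, ‖H ξ u‖ = G ξ u := by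
    intro ξ u
    rw [hH]
    simp only [Circle.norm_smul, Complex.norm_real]
    exact Real.norm_of_nonneg (Real.exp_nonneg _)
  have hmeas : AEStronglyMeasurable (Function.uncurry H)
      ((volume : Measure Plane).prod (volume.restrict (Ioi (0 : ℝ)))) := by
    have h1 : Continuous fun p : Plane × ℝ => Real.fourierChar (-inner ℝ p.1 y) := by fun_prop
    have h2 : Measurable fun p : Plane × ℝ => ((G p.1 p.2 : ℝ) : ℂ) := by
      simp only [hG]; fun_prop
    exact h1.aestronglyMeasurable.smul h2.aestronglyMeasurable
  have hprod : Integrable (Function.uncurry H)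
      ((volume : Measure Plane).prod (volume.restrict (Ioi (0 : ℝ)))) := by
    refine (integrable_prod_iff hmeas).2 ⟨Filter.Eventually.of_forall fun ξ => ?_, ?_⟩
    · simp only [Function.uncurry_apply_pair, hH]
      simp only [Circle.smul_def]
      exact ((hGint ξ).ofReal (𝕜 := ℂ)).smul (Real.fourierChar (-inner ℝ ξ y) : ℂ)
    · simp only [Function.uncurry_apply_pair, hnorm, hGval]
      refine Integrable.const_mul ?_ _
      simpa [norm_poissonSymbol] using
        (integrable_poissonSymbol (τ := (τ : ℂ)) (by simpa using hτ)).norm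
  have hsymb : ∀ ξ, ((Real.sqrt Real.pi / 2 : ℝ) : ℂ) •
      (Real.fourierChar (-inner ℝ ξ y) • poissonSymbol τ ξ) = ∫ u in Ioi (0 : ℝ), H ξ u := by
    intro ξ
    simp only [hH, Circle.smul_def]
    rw [integral_smul, integral_complex_ofReal, hGval, smul_comm]
    congr 1
    simp [poissonSymbol]
  have hinner : ∀ u ∈ Ioi (0 : ℝ), ∫ ξ, H ξ u =
      ((1 / (4 * Real.pi) * ((u ^ 2)⁻¹ * Real.exp (-u ^ 2 - B ^ 2 / (4 * u ^ 2))) : ℝ) : ℂ) := by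
    intro u hu
    have hu' : (0 : ℝ) < u := hu
    have hsplit : ∀ ξ, H ξ u = ((Real.exp (-u ^ 2 - τ ^ 2 / (4 * u ^ 2)) : ℝ) : ℂ) •
        (Real.fourierChar (-inner ℝ ξ y) •
          ((Real.exp (-((2 * Real.pi * u) ^ 2 * ‖ξ‖ ^ 2)) : ℝ) : ℂ)) := by
      intro ξ
      simp only [hH, hG]
      rw [smul_comm, smul_eq_mul, ← Complex.ofReal_mul, ← Real.exp_add, freq_sq]
      congr 3
      ring
    simp only [hsplit]
    rw [integral_smul, fourier_gaussian_plane hu', smul_eq_mul, ← Complex.ofReal_mul]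
    congr 1
    have h3 : Real.exp (-u ^ 2 - B ^ 2 / (4 * u ^ 2)) =
        Real.exp (-u ^ 2 - τ ^ 2 / (4 * u ^ 2)) * Real.exp (-‖y‖ ^ 2 / (4 * u ^ 2)) := by
      rw [← Real.exp_add, hBsq]
      congr 1
      ring
    rw [h3]
    field_simp
  have hmain : ((Real.sqrt Real.pi / 2 : ℝ) : ℂ) • 𝓕 (poissonSymbol τ) y =
      ((1 / (4 * Real.pi) * (Real.sqrt Real.pi * (Real.exp (-B) / B)) : ℝ) : ℂ) := by
    rw [Real.fourier_eq, ← integral_smul]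
    simp only [hsymb]
    rw [integral_integral_swap hprod, setIntegral_congr_fun measurableSet_Ioi hinner,
      integral_complex_ofReal, integral_const_mul, integral_inv_sq_mul_exp_neg_sq_sub_div_sq hBpos]
  have hne : ((Real.sqrt Real.pi / 2 : ℝ) : ℂ) ≠ 0 := by
    exact_mod_cast (by positivity : Real.sqrt Real.pi / 2 ≠ 0)
  have := congrArg (fun z => ((Real.sqrt Real.pi / 2 : ℝ) : ℂ)⁻¹ • z) hmain
  simp only [smul_smul, inv_mul_cancel₀ hne, one_smul] at this
  rw [this, smul_eq_mul, ← Complex.ofReal_inv, ← Complex.ofReal_mul]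
  congr 1
  field_simp
  norm_num

end Kernel

/-! ### Analytic continuation of the kernel to `Re τ > 0`, and its uniform bound. -/

section Continuation

/-- A square root of `|y|² + τ²`, holomorphic in `Re τ > 0`. -/
def lorentzRoot (y : Plane) (τ : ℂ) : ℂ :=
  Complex.exp (Complex.log ((‖y‖ ^ 2 : ℝ) + τ ^ 2) / 2)

/-- The imaginary part is `2 Re τ Im τ`, which vanishes only for real `τ`; the real part is then
positive. -/
theorem norm_sq_add_sq_mem_slitPlane (y : Plane) {τ : ℂ} (hτ : 0 < τ.re) :
    ((‖y‖ ^ 2 : ℝ) : ℂ) + τ ^ 2 ∈ Complex.slitPlane := by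
  rw [Complex.mem_slitPlane_iff]
  simp only [Complex.add_re, Complex.add_im, Complex.ofReal_re, Complex.ofReal_im, sq,
    Complex.mul_re, Complex.mul_im]
  by_cases h : τ.im = 0
  · left
    rw [h]
    nlinarith [norm_nonneg y, mul_pos hτ hτ, mul_self_nonneg ‖y‖]
  · right
    have := mul_ne_zero hτ.ne' h
    intro h0
    apply this
    linarith

theorem lorentzRoot_sq (y : Plane) {τ : ℂ} (hτ : 0 < τ.re) :
    lorentzRoot y τ ^ 2 = (‖y‖ ^ 2 : ℝ) + τ ^ 2 := by
  rw [lorentzRoot, ← Complex.exp_nat_mul]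
  rw [show ((2 : ℕ) : ℂ) * (Complex.log ((‖y‖ ^ 2 : ℝ) + τ ^ 2) / 2) =
    Complex.log ((‖y‖ ^ 2 : ℝ) + τ ^ 2) by push_cast; ring]
  exact Complex.exp_log (Complex.slitPlane_ne_zero (norm_sq_add_sq_mem_slitPlane y hτ))

theorem lorentzRoot_re_pos (y : Plane) {τ : ℂ} (hτ : 0 < τ.re) : 0 < (lorentzRoot y τ).re := by
  have h := Complex.mem_slitPlane_iff_arg.1 (norm_sq_add_sq_mem_slitPlane y hτ)
  set w : ℂ := ((‖y‖ ^ 2 : ℝ) : ℂ) + τ ^ 2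
  have h1 := Complex.neg_pi_lt_arg w
  have h2 := lt_of_le_of_ne (Complex.arg_le_pi w) h.1
  rw [lorentzRoot, Complex.exp_re]
  refine mul_pos (Real.exp_pos _) (Real.cos_pos_of_mem_Ioo ?_)
  have : (Complex.log w / 2).im = Complex.arg w / 2 := by
    rw [Complex.div_ofNat_im, Complex.log_im]
  rw [this]
  constructor <;> linarith

theorem lorentzRoot_ofReal (y : Plane) {τ : ℝ} (hτ : 0 < τ) :
    lorentzRoot y τ = (Real.sqrt (‖y‖ ^ 2 + τ ^ 2) : ℝ) := by
  have h : 0 < ‖y‖ ^ 2 + τ ^ 2 := by positivity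
  rw [lorentzRoot, ← Complex.ofReal_pow, ← Complex.ofReal_add, ← Complex.ofReal_log h.le]
  rw [Real.sqrt_eq_rpow, Real.rpow_def_of_pos h]
  push_cast
  congr 1
  ring

theorem differentiableAt_lorentzRoot (y : Plane) {τ : ℂ} (hτ : 0 < τ.re) :
    DifferentiableAt ℂ (lorentzRoot y) τ := by
  unfold lorentzRoot
  refine DifferentiableAt.cexp (DifferentiableAt.div_const (DifferentiableAt.clog ?_ ?_) _)
  · fun_prop
  · exact norm_sq_add_sq_mem_slitPlane y hτ

theorem differentiableAt_fourier_poissonSymbol (y : Plane) {τ : ℂ} (hτ : 0 < τ.re) :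
    DifferentiableAt ℂ (fun τ => 𝓕 (poissonSymbol τ) y) τ := by
  -- On the ball of radius `Re τ / 2` the damping stays at least `Re τ / 2`, which gives one
  -- integrable majorant for all the derivatives.
  have hε : 0 < τ.re / 2 := by positivity
  have hball : ∀ σ ∈ Metric.ball τ (τ.re / 2), τ.re / 2 < σ.re := by
    intro σ hσ
    have h1 : |(σ - τ).re| < τ.re / 2 :=
      (Complex.abs_re_le_norm _).trans_lt (by simpa [dist_eq_norm] using hσ)
    rw [Complex.sub_re, abs_lt] at h1
    linarith [h1.1]
  have hcont : ∀ σ, Continuous fun ξ : Plane =>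
      Real.fourierChar (-inner ℝ ξ y) • poissonSymbol σ ξ := by
    intro σ
    have := continuous_poissonSymbol σ
    fun_prop
  have hint : Integrable fun ξ : Plane => Real.fourierChar (-inner ℝ ξ y) • poissonSymbol τ ξ := by
    refine (integrable_poissonSymbol hτ).mono (hcont τ).aestronglyMeasurable
      (Filter.Eventually.of_forall fun ξ => ?_)
    rw [Circle.norm_smul]
  have h := hasDerivAt_integral_of_dominated_loc_of_deriv_le
    (F := fun σ ξ => Real.fourierChar (-inner ℝ ξ y) • poissonSymbol σ ξ)
    (F' := fun σ (ξ : Plane) =>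
      Real.fourierChar (-inner ℝ ξ y) • -Complex.exp (-(σ * freq ξ)))
    (bound := fun ξ => Real.exp (-(τ.re / 2 * freq ξ))) (μ := volume) (x₀ := τ)
    (s := Metric.ball τ (τ.re / 2)) (Metric.ball_mem_nhds τ hε)
    (Filter.Eventually.of_forall fun σ => (hcont σ).aestronglyMeasurable) hint
    (by fun_prop) ?_ (integrable_exp_neg_mul_freq hε) ?_
  · simp only [Real.fourier_eq]
    exact h.2.differentiableAt
  · refine Filter.Eventually.of_forall fun ξ σ hσ => ?_
    rw [Circle.norm_smul, norm_neg, Complex.norm_exp]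
    refine Real.exp_le_exp.2 ?_
    have := mul_le_mul_of_nonneg_right (hball σ hσ).le (freq_pos ξ).le
    simpa using this
  · refine Filter.Eventually.of_forall fun ξ σ _ => ?_
    have hne : (freq ξ : ℂ) ≠ 0 := by exact_mod_cast (freq_pos ξ).ne'
    have h1 : HasDerivAt (fun σ : ℂ => poissonSymbol σ ξ) (-Complex.exp (-(σ * freq ξ))) σ := by
      have h2 := ((((hasDerivAt_id' σ).mul_const (freq ξ : ℂ)).neg).cexp).div_const (freq ξ : ℂ)
      refine h2.congr_deriv ?_
      field_simp
      simp only [Pi.neg_apply, mul_comm]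
    simp only [Circle.smul_def]
    exact h1.const_smul (Real.fourierChar (-inner ℝ ξ y) : ℂ)

/-- The kernel of `exp (-τ⟨D⟩) / ⟨D⟩` on the plane. -/
theorem fourier_poissonSymbol (y : Plane) {τ : ℂ} (hτ : 0 < τ.re) :
    𝓕 (poissonSymbol τ) y =
      Complex.exp (-lorentzRoot y τ) / (2 * Real.pi * lorentzRoot y τ) := by
  set U : Set ℂ := {τ | 0 < τ.re} with hU
  have hUo : IsOpen U := isOpen_lt continuous_const Complex.continuous_re
  have hUc : IsPreconnected U := (convex_halfSpace_re_gt 0).isPreconnected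
  have hf : AnalyticOnNhd ℂ (fun τ => 𝓕 (poissonSymbol τ) y) U :=
    DifferentiableOn.analyticOnNhd
      (fun σ hσ => (differentiableAt_fourier_poissonSymbol y hσ).differentiableWithinAt) hUo
  have hg : AnalyticOnNhd ℂ (fun τ =>
      Complex.exp (-lorentzRoot y τ) / (2 * Real.pi * lorentzRoot y τ)) U := by
    refine DifferentiableOn.analyticOnNhd (fun σ hσ => ?_) hUo
    have hd := differentiableAt_lorentzRoot y hσ
    refine DifferentiableAt.differentiableWithinAt (DifferentiableAt.div hd.neg.cexp
      (hd.const_mul _) ?_)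
    refine mul_ne_zero ?_ (Complex.exp_ne_zero _)
    exact_mod_cast (by positivity : 2 * Real.pi ≠ 0)
  have hone : (1 : ℂ) ∈ U := by simp [hU]
  refine hf.eqOn_of_preconnected_of_frequently_eq hg hUc hone ?_ hτ
  -- The identity theorem needs agreement only at points accumulating at `1`; real numbers
  -- decreasing to `1` serve.
  have htend : Filter.Tendsto (fun r : ℝ => (r : ℂ)) (nhdsWithin 1 (Set.Ioi 1))
      (nhdsWithin (1 : ℂ) {1}ᶜ) := by
    refine tendsto_nhdsWithin_iff.2 ⟨?_, ?_⟩
    · exact (Complex.continuous_ofReal.tendsto' 1 1 (by simp)).mono_left nhdsWithin_le_nhds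
    · filter_upwards [self_mem_nhdsWithin] with r hr
      have : r ≠ 1 := ne_of_gt hr
      simpa using this
  refine htend.frequently (Filter.Eventually.frequently ?_)
  filter_upwards [self_mem_nhdsWithin] with r hr
  have hr' : 0 < r := lt_trans one_pos hr
  rw [fourier_poissonSymbol_of_real hr', lorentzRoot_ofReal y hr']
  push_cast
  rfl

/-- Comparing imaginary parts in `z² = ‖y‖² + τ²` gives `Re z · Im z = Re τ · Im τ`, whatever `y`
is. Then `exp(-Re z) ≤ 1 / Re z` and `|Im z| ≤ ‖z‖` give the bound. -/
theorem norm_fourier_poissonSymbol_le (y : Plane) {τ : ℂ} (hτ : 0 < τ.re) (hτ' : τ.im ≠ 0) :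
    ‖𝓕 (poissonSymbol τ) y‖ ≤ 1 / (τ.re * |τ.im|) := by
  rw [fourier_poissonSymbol y hτ]
  have hz := lorentzRoot_re_pos y hτ
  have hsq := lorentzRoot_sq y hτ
  generalize lorentzRoot y τ = z at *
  have him : z.re * z.im = τ.re * τ.im := by
    have := congrArg Complex.im hsq
    simp only [sq, Complex.add_im, Complex.mul_im, Complex.ofReal_im] at this
    linarith
  have hznorm : 0 < ‖z‖ := hz.trans_le (Complex.re_le_norm z)
  have hprod : τ.re * |τ.im| ≤ z.re * ‖z‖ := by
    rw [← abs_of_pos hτ, ← abs_mul, ← him, abs_mul, abs_of_pos hz]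
    exact mul_le_mul_of_nonneg_left (Complex.abs_im_le_norm z) hz.le
  have hpos : 0 < τ.re * |τ.im| := mul_pos hτ (abs_pos.2 hτ')
  have hexp : Real.exp (-z.re) ≤ 1 / z.re := by
    simpa using exp_neg_le_factorial_div_pow hz 1
  rw [norm_div, Complex.norm_exp, norm_mul, norm_mul, Complex.norm_real, Complex.norm_ofNat,
    Real.norm_of_nonneg Real.pi_pos.le, Complex.neg_re]
  have h2pi : (1 : ℝ) ≤ 2 * Real.pi := by linarith [Real.two_le_pi]
  calc Real.exp (-z.re) / (2 * Real.pi * ‖z‖) ≤ (1 / z.re) / (1 * ‖z‖) := by gcongr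
    _ = 1 / (z.re * ‖z‖) := by rw [one_mul, div_div]
    _ ≤ _ := by gcongr

end Continuation

/-! ### Exponentially damped symbols as Schwartz functions. -/

section ExponentialSchwartz

theorem Function.HasTemperateGrowth.fderiv_right {E F : Type*} [NormedAddCommGroup E]
    [NormedSpace ℝ E] [NormedAddCommGroup F] [NormedSpace ℝ F] {f : E → F}
    (hf : f.HasTemperateGrowth) : (fderiv ℝ f).HasTemperateGrowth := by
  refine ⟨hf.1.fderiv_right (by simp), fun n => ?_⟩
  obtain ⟨k, C, h⟩ := hf.2 (n + 1)
  exact ⟨k, C, fun x => by rw [norm_iteratedFDeriv_fderiv]; exact h x⟩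

theorem norm_le_freq (ξ : Plane) : ‖ξ‖ ≤ freq ξ := by
  have h := freq_sq ξ
  have h2 : (1 : ℝ) ≤ (2 * Real.pi) ^ 2 := by nlinarith [Real.two_le_pi]
  have h3 : ‖ξ‖ ^ 2 ≤ (2 * Real.pi) ^ 2 * ‖ξ‖ ^ 2 := le_mul_of_one_le_left (sq_nonneg _) h2
  exact (pow_le_pow_iff_left₀ (norm_nonneg _) (freq_pos ξ).le two_ne_zero).1 (by linarith)

/-- The gradient of `exp(-δ freq) a` is `exp(-δ freq)(∇a - δ a∇freq)`, again a damped function of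
temperate growth. The target space changes at each derivative, so the induction is over all `F` and
`a` at once. -/
theorem exp_neg_mul_freq_smul_decay {δ : ℝ} (hδ : 0 < δ) (n : ℕ) :
    ∀ {F : Type} [NormedAddCommGroup F] [NormedSpace ℝ F] (a : Plane → F),
      a.HasTemperateGrowth → ∀ k : ℕ, ∃ C : ℝ, ∀ ξ : Plane,
        ‖ξ‖ ^ k * ‖iteratedFDeriv ℝ n (fun ξ => Real.exp (-(δ * freq ξ)) • a ξ) ξ‖ ≤ C := by
  induction n with
  | zero =>
    intro F _ _ a ha k
    obtain ⟨j, C, h⟩ := ha.2 0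
    refine ⟨C * 2 ^ j * ((k + j).factorial / δ ^ (k + j)), fun ξ => ?_⟩
    have hf := freq_pos ξ
    have h1 : ‖a ξ‖ ≤ C * (1 + ‖ξ‖) ^ j := by simpa using h ξ
    have hC : 0 ≤ C := by
      have := h 0
      simp only [norm_zero, add_zero, one_pow, mul_one] at this
      exact (norm_nonneg _).trans this
    have h2 : (1 + ‖ξ‖) ^ j ≤ (2 * freq ξ) ^ j := by
      gcongr
      linarith [norm_le_freq ξ, one_le_freq ξ]
    have h3 : ‖ξ‖ ^ k ≤ freq ξ ^ k := by
      gcongr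
      exact norm_le_freq ξ
    have h4 := exp_neg_le_factorial_div_pow (mul_pos hδ hf) (k + j)
    rw [norm_iteratedFDeriv_zero, norm_smul, Real.norm_of_nonneg (Real.exp_nonneg _)]
    calc ‖ξ‖ ^ k * (Real.exp (-(δ * freq ξ)) * ‖a ξ‖)
        ≤ freq ξ ^ k * (((k + j).factorial / (δ * freq ξ) ^ (k + j)) *
            (C * (2 * freq ξ) ^ j)) := by
          gcongr
          exact h1.trans (by gcongr)
      _ = _ := by
          rw [mul_pow, mul_pow, pow_add (freq ξ)]
          field_simp
  | succ n ih =>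
    intro F _ _ a ha k
    have hfd := freq_hasTemperateGrowth
    have hb : (fun ξ => fderiv ℝ a ξ - δ • (fderiv ℝ freq ξ).smulRight (a ξ)).HasTemperateGrowth :=
      ha.fderiv_right.sub ((Function.HasTemperateGrowth.const δ).smul
        ((ContinuousLinearMap.smulRightL ℝ Plane F).bilinear_hasTemperateGrowth
          hfd.fderiv_right ha))
    obtain ⟨C, hC⟩ := ih _ hb k
    refine ⟨C, fun ξ => ?_⟩
    rw [← norm_iteratedFDeriv_fderiv]
    have hder : fderiv ℝ (fun ξ => Real.exp (-(δ * freq ξ)) • a ξ) =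
        fun ξ => Real.exp (-(δ * freq ξ)) •
          (fderiv ℝ a ξ - δ • (fderiv ℝ freq ξ).smulRight (a ξ)) := by
      ext1 ξ
      have hd1 : HasFDerivAt freq (fderiv ℝ freq ξ) ξ :=
        (hfd.1.differentiable (by simp) ξ).hasFDerivAt
      have hd2 : HasFDerivAt a (fderiv ℝ a ξ) ξ :=
        (ha.1.differentiable (by simp) ξ).hasFDerivAt
      have hd3 := ((hd1.const_mul δ).neg.exp).smul hd2
      refine hd3.fderiv.trans ?_
      ext v
      simp [smul_smul, sub_eq_add_neg]
    rw [hder]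
    exact hC ξ

/-- The Schwartz function `exp (-δ⟨2πξ⟩) a(ξ)`, for `a` of temperate growth. -/
def expSchwartz {δ : ℝ} (hδ : 0 < δ) {a : Plane → ℂ} (ha : a.HasTemperateGrowth) :
    𝓢(Plane, ℂ) where
  toFun ξ := Real.exp (-(δ * freq ξ)) • a ξ
  smooth' := by
    have h1 := freq_hasTemperateGrowth.1
    have h2 := ha.1
    fun_prop
  decay' k n := exp_neg_mul_freq_smul_decay hδ n a ha k

theorem hasTemperateGrowth_cexp_mul_I :
    (fun r : ℝ => Complex.exp ((r : ℂ) * Complex.I)).HasTemperateGrowth := by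
  have hd : ∀ r : ℝ, HasDerivAt (fun r : ℝ => Complex.exp ((r : ℂ) * Complex.I))
      (Complex.I * Complex.exp ((r : ℂ) * Complex.I)) r := by
    intro r
    have := ((Complex.ofRealCLM.hasDerivAt (x := r)).mul_const Complex.I).cexp
    simpa [mul_comm] using this
  have hn : ∀ n : ℕ, iteratedDeriv n (fun r : ℝ => Complex.exp ((r : ℂ) * Complex.I)) =
      fun r : ℝ => Complex.I ^ n * Complex.exp ((r : ℂ) * Complex.I) := by
    intro n
    induction n with
    | zero => ext r; simp
    | succ n ih =>
      rw [iteratedDeriv_succ, ih]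
      ext r
      rw [((hd r).const_mul _).deriv]
      ring
  refine ⟨(Complex.ofRealCLM.contDiff.mul contDiff_const).cexp, fun n => ⟨0, 1, fun r => ?_⟩⟩
  rw [norm_iteratedFDeriv_eq_norm_iteratedDeriv, hn]
  simp [Complex.norm_exp]

/-- The character `ξ ↦ exp (2πi x·ξ)`. -/
def planeWave (x ξ : Plane) : ℂ := (Real.fourierChar (inner ℝ ξ x) : ℂ)

theorem norm_planeWave (x ξ : Plane) : ‖planeWave x ξ‖ = 1 := Circle.norm_coe _

@[fun_prop]
theorem continuous_planeWave (x : Plane) : Continuous (planeWave x) := by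
  unfold planeWave; fun_prop

theorem hasTemperateGrowth_planeWave (x : Plane) : (planeWave x).HasTemperateGrowth := by
  have h2 : (fun ξ : Plane => 2 * Real.pi * inner ℝ ξ x).HasTemperateGrowth := by fun_prop
  convert hasTemperateGrowth_cexp_mul_I.comp h2 using 1
  ext ξ
  simp [planeWave, Real.fourierChar_apply]

end ExponentialSchwartz

/-! ### Cauchy-Schwarz for pairings with `L²` spinors. -/

section L2Pairing

variable {f : Plane → ℂ}

theorem MeasureTheory.MemLp.integrable_smul_Lp_two (hf : MemLp f 2)
    (V : Lp Spinor 2 (volume : Measure Plane)) : Integrable fun ξ => f ξ • V ξ :=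
  memLp_one_iff_integrable.1 ((Lp.memLp V).smul (r := 1) hf)

theorem norm_integral_smul_le (hf : MemLp f 2) (V : Lp Spinor 2 (volume : Measure Plane)) :
    ‖∫ ξ, f ξ • V ξ‖ ≤ (eLpNorm f 2 volume).toReal * ‖V‖ := by
  have h1 : eLpNorm (f • ⇑V) 1 volume ≤ eLpNorm f 2 volume * eLpNorm V 2 volume :=
    eLpNorm_smul_le_mul_eLpNorm (Lp.memLp V).1 hf.1
  have h2 : ‖∫ ξ, f ξ • V ξ‖ₑ ≤ eLpNorm f 2 volume * eLpNorm V 2 volume := by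
    refine (enorm_integral_le_lintegral_enorm _).trans ?_
    rw [eLpNorm_one_eq_lintegral_enorm] at h1
    exact h1
  have h3 := ENNReal.toReal_mono (ENNReal.mul_ne_top hf.2.ne (Lp.memLp V).2.ne) h2
  rwa [toReal_enorm, ENNReal.toReal_mul, ← Lp.norm_def] at h3

theorem toReal_eLpNorm_two_eq_sqrt {F : Type*} [NormedAddCommGroup F] {f : Plane → F}
    (hf : MemLp f 2) :
    (eLpNorm f 2 volume).toReal = Real.sqrt (∫ ξ, ‖f ξ‖ ^ 2) := by
  rw [hf.eLpNorm_eq_integral_rpow_norm (by norm_num) (by norm_num), ENNReal.toReal_ofReal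
    (by positivity), Real.sqrt_eq_rpow]
  simp

theorem norm_integral_mul_smul_le {c : Plane → ℂ} (hc : AEStronglyMeasurable c volume) {M : ℝ}
    (hM : 0 ≤ M) (hcM : ∀ ξ, ‖c ξ‖ ≤ M) (Θ : 𝓢(Plane, ℂ))
    (V : Lp Spinor 2 (volume : Measure Plane)) :
    (Integrable fun ξ => (c ξ * Θ ξ) • V ξ) ∧
    ‖∫ ξ, (c ξ * Θ ξ) • V ξ‖ ≤ M * ‖Θ.toLp 2 volume‖ * ‖V‖ := by
  have hΘ := Θ.memLp 2 volume
  have hle : ∀ᵐ ξ : Plane, ‖c ξ * Θ ξ‖ ≤ M * ‖Θ ξ‖ := Filter.Eventually.of_forall fun ξ => by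
    rw [norm_mul]
    exact mul_le_mul_of_nonneg_right (hcM ξ) (norm_nonneg _)
  have hmem : MemLp (fun ξ => c ξ * Θ ξ) 2 volume := hΘ.of_le_mul (hc.mul hΘ.1) hle
  refine ⟨hmem.integrable_smul_Lp_two V, (norm_integral_smul_le hmem V).trans ?_⟩
  gcongr
  have h := eLpNorm_le_mul_eLpNorm_of_ae_le_mul hle 2
  have h2 := ENNReal.toReal_mono (ENNReal.mul_ne_top ENNReal.ofReal_ne_top hΘ.2.ne) h
  rwa [ENNReal.toReal_mul, ENNReal.toReal_ofReal hM, ← SchwartzMap.norm_toLp] at h2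

theorem SchwartzMap.norm_toLp_two (Φ : 𝓢(Plane, ℂ)) :
    ‖Φ.toLp 2 volume‖ = Real.sqrt (∫ y, ‖Φ y‖ ^ 2) := by
  rw [SchwartzMap.norm_toLp, toReal_eLpNorm_two_eq_sqrt (Φ.memLp 2 volume)]

theorem SchwartzMap.integrable_norm_sq (Φ : 𝓢(Plane, ℂ)) :
    Integrable fun y => ‖Φ y‖ ^ 2 :=
  (Φ.memLp 2 volume).integrable_norm_pow (by norm_num)

end L2Pairing

/-! ### Duality between a weighted `L²` norm and weak derivatives in frequency. -/

section WeightedDuality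

/-- The function `(1 + |y|²)⁻¹`. -/
def invWeight (y : Plane) : ℂ := (((1 + ‖y‖ ^ 2) ^ (-1 : ℝ) : ℝ) : ℂ)

theorem hasTemperateGrowth_invWeight : invWeight.HasTemperateGrowth :=
  Function.Complex.hasTemperateGrowth_ofReal.comp (g := Complex.ofReal)
    (f := fun y : Plane => (1 + ‖y‖ ^ 2) ^ (-1 : ℝ)) (by fun_prop)

theorem invWeight_eq (y : Plane) : invWeight y = ((1 + ‖y‖ ^ 2 : ℝ) : ℂ)⁻¹ := by
  rw [invWeight, Real.rpow_neg_one, Complex.ofReal_inv]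

theorem norm_invWeight (y : Plane) : ‖invWeight y‖ = (1 + ‖y‖ ^ 2)⁻¹ := by
  rw [invWeight_eq, norm_inv, Complex.norm_real, Real.norm_of_nonneg (by positivity)]

/-- The coordinate function `y_j` with complex values. -/
def coordC (j : Fin 2) (y : Plane) : ℂ := ((y j : ℝ) : ℂ)

theorem hasTemperateGrowth_coordC (j : Fin 2) : (coordC j).HasTemperateGrowth :=
  hasTemperateGrowth_coord j

/-- The part `Φ / (1 + |y|²)` of `Φ`. -/
def centralPart (Φ : 𝓢(Plane, ℂ)) : 𝓢(Plane, ℂ) := SchwartzMap.smulLeftCLM ℂ invWeight Φ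

/-- The part `y_j Φ / (1 + |y|²)` of `Φ`. -/
def coordPart (j : Fin 2) (Φ : 𝓢(Plane, ℂ)) : 𝓢(Plane, ℂ) :=
  SchwartzMap.smulLeftCLM ℂ (coordC j) (centralPart Φ)

theorem centralPart_apply (Φ : 𝓢(Plane, ℂ)) (y : Plane) :
    centralPart Φ y = invWeight y * Φ y := by
  simp [centralPart, hasTemperateGrowth_invWeight]

theorem coordPart_apply (j : Fin 2) (Φ : 𝓢(Plane, ℂ)) (y : Plane) :
    coordPart j Φ y = coordC j y * (invWeight y * Φ y) := by
  simp [coordPart, hasTemperateGrowth_coordC, centralPart_apply]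

/-- Divide `1 + ‖y‖² = 1 + y₀² + y₁²` by itself. The point of this form is that `centralPart` and
`coordPart` both have `L²` norm at most `decayNorm Φ`, and the remaining factor `y_j` becomes a
derivative in frequency. -/
theorem eq_centralPart_add_sum (Φ : 𝓢(Plane, ℂ)) :
    Φ = centralPart Φ + ∑ j, SchwartzMap.smulLeftCLM ℂ (coordC j) (coordPart j Φ) := by
  ext y
  have h : (1 : ℝ) + ‖y‖ ^ 2 ≠ 0 := by positivity
  have hc : ((1 + ‖y‖ ^ 2 : ℝ) : ℂ) ≠ 0 := by exact_mod_cast h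
  have hsum : ((1 + ‖y‖ ^ 2 : ℝ) : ℂ) = 1 + coordC 0 y * coordC 0 y + coordC 1 y * coordC 1 y := by
    rw [EuclideanSpace.norm_sq_eq, Fin.sum_univ_two]
    simp only [coordC, Real.norm_eq_abs, sq_abs]
    push_cast
    ring
  simp only [Fin.sum_univ_two, add_apply,
    SchwartzMap.smulLeftCLM_apply_apply (hasTemperateGrowth_coordC _), smul_eq_mul,
    coordPart_apply, centralPart_apply]
  calc Φ y = ((1 + ‖y‖ ^ 2 : ℝ) : ℂ) * (invWeight y * Φ y) := by
        rw [invWeight_eq, ← mul_assoc, mul_inv_cancel₀ hc, one_mul]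
    _ = _ := by rw [hsum]; ring

/-- The norm of `Φ / ⟨y⟩` in `L²`. -/
def decayNorm (Φ : 𝓢(Plane, ℂ)) : ℝ := Real.sqrt (∫ y, ‖Φ y‖ ^ 2 * (1 + ‖y‖ ^ 2)⁻¹)

theorem integrable_norm_sq_mul_inv (Φ : 𝓢(Plane, ℂ)) :
    Integrable fun y => ‖Φ y‖ ^ 2 * (1 + ‖y‖ ^ 2)⁻¹ := by
  refine Φ.integrable_norm_sq.mono' ?_ (Filter.Eventually.of_forall fun y => ?_)
  · have := Φ.continuous
    refine Continuous.aestronglyMeasurable ((by fun_prop : Continuous fun y => ‖Φ y‖ ^ 2).mul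
      (Continuous.inv₀ (by fun_prop) fun y => by positivity))
  · rw [Real.norm_of_nonneg (by positivity)]
    exact mul_le_of_le_one_right (by positivity)
      (inv_le_one_of_one_le₀ (by linarith [sq_nonneg ‖y‖]))

theorem norm_centralPart_le (Φ : 𝓢(Plane, ℂ)) : ‖(centralPart Φ).toLp 2 volume‖ ≤ decayNorm Φ := by
  rw [SchwartzMap.norm_toLp_two]
  refine Real.sqrt_le_sqrt (integral_mono (centralPart Φ).integrable_norm_sq
    (integrable_norm_sq_mul_inv Φ) fun y => ?_)
  simp only [centralPart_apply, norm_mul, norm_invWeight, mul_pow]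
  have h : (1 + ‖y‖ ^ 2)⁻¹ ≤ (1 : ℝ) := inv_le_one_of_one_le₀ (by linarith [sq_nonneg ‖y‖])
  have h0 : 0 ≤ (1 + ‖y‖ ^ 2)⁻¹ := by positivity
  rw [mul_comm]
  refine mul_le_mul_of_nonneg_left ?_ (by positivity)
  nlinarith

theorem norm_coordPart_le (j : Fin 2) (Φ : 𝓢(Plane, ℂ)) :
    ‖(coordPart j Φ).toLp 2 volume‖ ≤ decayNorm Φ := by
  rw [SchwartzMap.norm_toLp_two]
  refine Real.sqrt_le_sqrt (integral_mono (coordPart j Φ).integrable_norm_sq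
    (integrable_norm_sq_mul_inv Φ) fun y => ?_)
  simp only [coordPart_apply, norm_mul, norm_invWeight, mul_pow]
  have h1 : ‖coordC j y‖ ^ 2 ≤ 1 + ‖y‖ ^ 2 := by
    have : ‖coordC j y‖ ≤ ‖y‖ := by
      rw [coordC, Complex.norm_real]
      exact PiLp.norm_apply_le y j
    nlinarith [norm_nonneg (coordC j y)]
  have h0 : 0 < 1 + ‖y‖ ^ 2 := by positivity
  calc ‖coordC j y‖ ^ 2 * ((1 + ‖y‖ ^ 2)⁻¹ ^ 2 * ‖Φ y‖ ^ 2)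
      ≤ (1 + ‖y‖ ^ 2) * ((1 + ‖y‖ ^ 2)⁻¹ ^ 2 * ‖Φ y‖ ^ 2) := by gcongr
    _ = _ := by field_simp

theorem fourier_coordC_smul (j : Fin 2) (Φ : 𝓢(Plane, ℂ)) :
    (-(2 * Real.pi * Complex.I)) • 𝓕 (SchwartzMap.smulLeftCLM ℂ (coordC j) Φ) =
      ∂_{EuclideanSpace.single j (1 : ℝ)} (𝓕 Φ) := by
  rw [SchwartzMap.lineDerivOp_fourier_eq, ← FourierTransform.fourier_smul]
  congr 2
  have h : (fun x : Plane => inner ℝ x (EuclideanSpace.single j (1 : ℝ))).HasTemperateGrowth := by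
    fun_prop
  rw [← SchwartzMap.smulLeftCLM_ofReal ℂ h]
  congr 2
  ext x
  simp [coordC, EuclideanSpace.inner_single_right]

theorem fourier_lineDeriv_single (j : Fin 2) (χ : 𝓢(Plane, ℂ)) :
    𝓕 (∂_{EuclideanSpace.single j (1 : ℝ)} χ) =
      (2 * Real.pi * Complex.I) • SchwartzMap.smulLeftCLM ℂ (coordC j) (𝓕 χ) := by
  rw [SchwartzMap.fourier_lineDerivOp_eq]
  congr 1
  have h : (fun x : Plane => inner ℝ x (EuclideanSpace.single j (1 : ℝ))).HasTemperateGrowth := by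
    fun_prop
  rw [← SchwartzMap.smulLeftCLM_ofReal ℂ h]
  congr 2
  ext x
  simp [coordC, EuclideanSpace.inner_single_right]

/-- Pairing with a function `b V` that has the weak derivatives `c W_j`, up to the factor `2πi`. -/
theorem norm_integral_mul_fourier_smul_le {b c m : Plane → ℂ}
    (hb : AEStronglyMeasurable b volume) (hc : AEStronglyMeasurable c volume)
    (hm : m.HasTemperateGrowth)
    (V : Lp Spinor 2 (volume : Measure Plane)) (W : Fin 2 → Lp Spinor 2 (volume : Measure Plane))
    (hVW : ∀ (j : Fin 2) (χ : 𝓢(Plane, ℂ)),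
      (2 * Real.pi * Complex.I) • ∫ ξ, (c ξ * χ ξ) • W j ξ =
        ∫ ξ, (b ξ * (∂_{EuclideanSpace.single j (1 : ℝ)} χ) ξ) • V ξ)
    {M₀ M₁ M₂ E : ℝ} (hM₀ : 0 ≤ M₀) (hM₁ : 0 ≤ M₁) (hM₂ : 0 ≤ M₂)
    (hbound : ∀ ξ, ‖b ξ‖ ≤ 1)
    (h₀ : ∀ ξ, ‖b ξ * m ξ‖ ≤ M₀) (h₁ : ∀ ξ, ‖c ξ * m ξ‖ ≤ M₁)
    (h₂ : ∀ j ξ, ‖b ξ * fderiv ℝ m ξ (EuclideanSpace.single j (1 : ℝ))‖ ≤ M₂)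
    (hV : ‖V‖ ≤ E) (hW : ∀ j, ‖W j‖ ≤ E) (Φ : 𝓢(Plane, ℂ)) :
    ‖∫ ξ, (b ξ * m ξ * (𝓕 Φ) ξ) • V ξ‖ ≤ (M₀ + 2 * M₁ + 2 * M₂) * decayNorm Φ * E := by
  have hE : 0 ≤ E := (norm_nonneg V).trans hV
  have hN : 0 ≤ decayNorm Φ := Real.sqrt_nonneg _
  have hmm : AEStronglyMeasurable m volume := hm.1.continuous.aestronglyMeasurable
  have hdm : ∀ j, AEStronglyMeasurable
      (fun ξ => fderiv ℝ m ξ (EuclideanSpace.single j (1 : ℝ))) volume := fun j =>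
    ((hm.1.continuous_fderiv (by simp)).clm_apply continuous_const).aestronglyMeasurable
  set κ : ℂ := -(2 * Real.pi * Complex.I) with hκ
  have hκ0 : κ ≠ 0 := by
    have : (Real.pi : ℂ) ≠ 0 := by exact_mod_cast Real.pi_ne_zero
    simp [hκ, this]
  have hκn : ‖κ‖ = 2 * Real.pi := by
    simp [hκ, abs_of_pos Real.pi_pos]
  have hκinv : ‖κ⁻¹‖ ≤ 1 := by
    rw [norm_inv, hκn]
    exact inv_le_one_of_one_le₀ (by linarith [Real.two_le_pi])
  set Θ : Fin 2 → 𝓢(Plane, ℂ) := fun j => 𝓕 (coordPart j Φ) with hΘ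
  set Θ₀ : 𝓢(Plane, ℂ) := 𝓕 (centralPart Φ) with hΘ₀
  have hΘn : ∀ j, ‖(Θ j).toLp 2 volume‖ ≤ decayNorm Φ := fun j => by
    rw [hΘ]; simp only [SchwartzMap.norm_fourier_toL2_eq]; exact norm_coordPart_le j Φ
  have hΘ₀n : ‖Θ₀.toLp 2 volume‖ ≤ decayNorm Φ := by
    rw [hΘ₀, SchwartzMap.norm_fourier_toL2_eq]; exact norm_centralPart_le Φ
  -- The Fourier image of the decomposition: multiplication by `y_j` is `κ⁻¹ ∂_j`.
  have hdecomp : ∀ ξ, (𝓕 Φ) ξ =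
      Θ₀ ξ + ∑ j, κ⁻¹ * (∂_{EuclideanSpace.single j (1 : ℝ)} (Θ j)) ξ := by
    intro ξ
    have h1 : 𝓕 Φ = Θ₀ + ∑ j, 𝓕 (SchwartzMap.smulLeftCLM ℂ (coordC j) (coordPart j Φ)) := by
      conv_lhs => rw [eq_centralPart_add_sum Φ]
      simp only [Fin.sum_univ_two, FourierTransform.fourier_add, hΘ₀]
    have h2 : ∀ j, 𝓕 (SchwartzMap.smulLeftCLM ℂ (coordC j) (coordPart j Φ)) =
        κ⁻¹ • ∂_{EuclideanSpace.single j (1 : ℝ)} (Θ j) := by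
      intro j
      rw [hΘ, ← fourier_coordC_smul, smul_smul, inv_mul_cancel₀ hκ0, one_smul]
    rw [h1]
    simp only [h2, Fin.sum_univ_two, add_apply, smul_apply, smul_eq_mul]
  -- The multiplier `m` is moved inside the derivative, so that `hVW` can be applied to the Schwartz
  -- function `m Θ_j`; the commutator is what `M₂` controls.
  have hleib : ∀ j ξ, m ξ * (∂_{EuclideanSpace.single j (1 : ℝ)} (Θ j)) ξ =
      (∂_{EuclideanSpace.single j (1 : ℝ)} (SchwartzMap.smulLeftCLM ℂ m (Θ j))) ξ -
        fderiv ℝ m ξ (EuclideanSpace.single j (1 : ℝ)) * Θ j ξ := by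
    intro j ξ
    have h1 := ((hm.1.differentiable (by simp) ξ).hasFDerivAt).mul ((Θ j).hasFDerivAt ξ)
    have h2 : (SchwartzMap.smulLeftCLM ℂ m (Θ j) : Plane → ℂ) = m * Θ j := by
      rw [SchwartzMap.smulLeftCLM_apply hm]; rfl
    rw [SchwartzMap.lineDerivOp_apply_eq_fderiv, SchwartzMap.lineDerivOp_apply_eq_fderiv, h2,
      h1.fderiv]
    simp
    ring
  set I₀ := ∫ ξ, (b ξ * m ξ * Θ₀ ξ) • V ξ with hI₀
  set I₁ : Fin 2 → Spinor := fun j => ∫ ξ, (c ξ * m ξ * Θ j ξ) • W j ξ with hI₁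
  set I₂ : Fin 2 → Spinor := fun j =>
    ∫ ξ, (b ξ * fderiv ℝ m ξ (EuclideanSpace.single j (1 : ℝ)) * Θ j ξ) • V ξ with hI₂
  obtain ⟨hint₀, hle₀⟩ := norm_integral_mul_smul_le (hb.mul hmm) hM₀ h₀ Θ₀ V
  have hpair₁ := fun j => norm_integral_mul_smul_le (hc.mul hmm) hM₁ h₁ (Θ j) (W j)
  have hpair₂ := fun j => norm_integral_mul_smul_le (hb.mul (hdm j)) hM₂ (h₂ j) (Θ j) V
  have hpair₃ := fun j => norm_integral_mul_smul_le hb zero_le_one hbound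
    (∂_{EuclideanSpace.single j (1 : ℝ)} (SchwartzMap.smulLeftCLM ℂ m (Θ j))) V
  have hsplit : ∫ ξ, (b ξ * m ξ * (𝓕 Φ) ξ) • V ξ =
      I₀ + ∑ j, κ⁻¹ • ((2 * Real.pi * Complex.I) • I₁ j - I₂ j) := by
    have h1 : ∀ j, (2 * Real.pi * Complex.I) • I₁ j =
        ∫ ξ, (b ξ * (∂_{EuclideanSpace.single j (1 : ℝ)}
          (SchwartzMap.smulLeftCLM ℂ m (Θ j))) ξ) • V ξ := by
      intro j
      rw [← hVW]
      simp only [hI₁, SchwartzMap.smulLeftCLM_apply_apply hm, smul_eq_mul, mul_assoc]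
    have h2 : ∀ j, κ⁻¹ • ((2 * Real.pi * Complex.I) • I₁ j - I₂ j) =
        ∫ ξ, κ⁻¹ • ((b ξ * (∂_{EuclideanSpace.single j (1 : ℝ)}
          (SchwartzMap.smulLeftCLM ℂ m (Θ j))) ξ) • V ξ -
          (b ξ * fderiv ℝ m ξ (EuclideanSpace.single j (1 : ℝ)) * Θ j ξ) • V ξ) := by
      intro j
      have h3 := integral_sub (hpair₃ j).1 (hpair₂ j).1
      simp only [Pi.mul_apply] at h3
      rw [integral_smul, h1, h3]
    have hint : ∀ j, Integrable fun ξ => κ⁻¹ • ((b ξ * (∂_{EuclideanSpace.single j (1 : ℝ)}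
          (SchwartzMap.smulLeftCLM ℂ m (Θ j))) ξ) • V ξ -
          (b ξ * fderiv ℝ m ξ (EuclideanSpace.single j (1 : ℝ)) * Θ j ξ) • V ξ) :=
      fun j => ((hpair₃ j).1.sub (hpair₂ j).1).smul κ⁻¹
    have hint₀' : Integrable fun ξ => (b ξ * m ξ * Θ₀ ξ) • V ξ := hint₀
    simp only [h2, hI₀]
    rw [← integral_finsetSum _ fun j _ => hint j,
      ← integral_add hint₀' (integrable_finsetSum _ fun j _ => hint j)]
    refine integral_congr_ae (Filter.Eventually.of_forall fun ξ => ?_)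
    simp only [hdecomp, Fin.sum_univ_two, ← sub_smul, smul_smul, ← add_smul]
    congr 1
    linear_combination b ξ * κ⁻¹ * (hleib 0 ξ) + b ξ * κ⁻¹ * (hleib 1 ξ)
  have hb₀ : ‖I₀‖ ≤ M₀ * decayNorm Φ * E := hle₀.trans (by gcongr)
  have hb₁ : ∀ j, ‖I₁ j‖ ≤ M₁ * decayNorm Φ * E := fun j =>
    (hpair₁ j).2.trans (by gcongr; exacts [hΘn j, hW j])
  have hb₂ : ∀ j, ‖I₂ j‖ ≤ M₂ * decayNorm Φ * E := fun j =>
    (hpair₂ j).2.trans (by gcongr; exact hΘn j)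
  have hterm : ∀ j, ‖κ⁻¹ • ((2 * Real.pi * Complex.I) • I₁ j - I₂ j)‖ ≤
      (M₁ + M₂) * decayNorm Φ * E := by
    intro j
    -- The factor `2πi` equals `-κ` and cancels against `κ⁻¹`, leaving `I₁ j` with coefficient `-1`.
    have h1 : κ⁻¹ • ((2 * Real.pi * Complex.I) • I₁ j - I₂ j) = -(I₁ j) - κ⁻¹ • I₂ j := by
      rw [smul_sub, smul_smul, show (2 * Real.pi * Complex.I : ℂ) = -κ by rw [hκ, neg_neg],
        mul_neg, inv_mul_cancel₀ hκ0, neg_one_smul]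
    rw [h1]
    refine (norm_sub_le _ _).trans ?_
    rw [norm_neg, norm_smul]
    have := mul_le_mul hκinv (hb₂ j) (norm_nonneg _) zero_le_one
    linarith [hb₁ j]
  rw [hsplit, Fin.sum_univ_two]
  refine (norm_add_le _ _).trans ?_
  have := norm_add_le (κ⁻¹ • ((2 * Real.pi * Complex.I) • I₁ 0 - I₂ 0))
    (κ⁻¹ • ((2 * Real.pi * Complex.I) • I₁ 1 - I₂ 1))
  linarith [hterm 0, hterm 1]

end WeightedDuality

/-! ### Decay of the damped low-frequency pieces. -/

section LowFrequency

theorem bracketSymbol_eq (r : ℝ) (ξ : Plane) : bracketSymbol r ξ = ((freq ξ ^ r : ℝ) : ℂ) := rfl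

theorem norm_bracketSymbol (r : ℝ) (ξ : Plane) : ‖bracketSymbol r ξ‖ = freq ξ ^ r := by
  rw [bracketSymbol_eq, Complex.norm_real,
    Real.norm_of_nonneg (Real.rpow_nonneg (freq_pos ξ).le r)]

theorem bracketSymbol_mul (r r' : ℝ) (ξ : Plane) :
    bracketSymbol r ξ * bracketSymbol r' ξ = bracketSymbol (r + r') ξ := by
  simp only [bracketSymbol_eq]
  rw [Real.rpow_add (freq_pos ξ), Complex.ofReal_mul]

theorem propagatorSymbol_eq (σ : ℝ) (ξ : Plane) :
    propagatorSymbol σ ξ = Complex.exp ((σ * freq ξ : ℝ) * Complex.I) := rfl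

theorem norm_propagatorSymbol (σ : ℝ) (ξ : Plane) : ‖propagatorSymbol σ ξ‖ = 1 := by
  rw [propagatorSymbol_eq, Complex.norm_exp_ofReal_mul_I]

theorem propagatorSymbol_mul_neg (σ : ℝ) (ξ : Plane) :
    propagatorSymbol σ ξ * propagatorSymbol (-σ) ξ = 1 := by
  rw [propagatorSymbol_eq, propagatorSymbol_eq, ← Complex.exp_add]
  push_cast
  simp

/-- A plane wave times the symbol of `exp (-(δ + iσ)⟨D⟩) / ⟨D⟩`. -/
def wavePoisson {δ : ℝ} (hδ : 0 < δ) (σ : ℝ) (x : Plane) : 𝓢(Plane, ℂ) :=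
  expSchwartz hδ (((hasTemperateGrowth_planeWave x).mul
    (hasTemperateGrowth_propagatorSymbol (-σ))).mul (hasTemperateGrowth_bracketSymbol (-1)))

theorem wavePoisson_apply {δ : ℝ} (hδ : 0 < δ) (σ : ℝ) (x ξ : Plane) :
    wavePoisson hδ σ x ξ = Real.exp (-(δ * freq ξ)) •
      (planeWave x ξ * propagatorSymbol (-σ) ξ * bracketSymbol (-1) ξ) := rfl

theorem wavePoisson_eq {δ : ℝ} (hδ : 0 < δ) (σ : ℝ) (x ξ : Plane) :
    wavePoisson hδ σ x ξ = planeWave x ξ * poissonSymbol (δ + σ * Complex.I) ξ := by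
  rw [wavePoisson_apply, propagatorSymbol_eq, bracketSymbol_eq, poissonSymbol, Real.rpow_neg_one,
    Complex.real_smul, Complex.ofReal_exp]
  have h : Complex.exp (-((δ + σ * Complex.I) * freq ξ)) =
      Complex.exp ((-(δ * freq ξ) : ℝ)) * Complex.exp ((-σ * freq ξ : ℝ) * Complex.I) := by
    rw [← Complex.exp_add]
    congr 1
    push_cast
    ring
  rw [h, Complex.ofReal_inv]
  ring

/-- The plane wave only translates and reflects the kernel, so the sup bound does not depend on `x`.
The same holds for the `L²` bound that follows, which is why the weight may stay centred at the
origin. -/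
theorem norm_fourierInv_wavePoisson_le {δ : ℝ} (hδ : 0 < δ) {σ : ℝ} (hσ : σ ≠ 0) (x y : Plane) :
    ‖(𝓕⁻ (wavePoisson hδ σ x)) y‖ ≤ (δ * |σ|)⁻¹ := by
  have h : (𝓕⁻ (wavePoisson hδ σ x)) y = 𝓕 (poissonSymbol (δ + σ * Complex.I)) (-(x + y)) := by
    rw [SchwartzMap.fourierInv_coe, Real.fourierInv_eq, Real.fourier_eq]
    refine integral_congr_ae (Filter.Eventually.of_forall fun ξ => ?_)
    simp only [wavePoisson_eq, planeWave, Circle.smul_def, smul_eq_mul]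
    rw [← mul_assoc, ← Circle.coe_mul, ← AddChar.map_add_eq_mul]
    congr 3
    simp only [inner_neg_right, inner_add_right]
    ring_nf
  rw [h]
  have h2 := norm_fourier_poissonSymbol_le (-(x + y)) (τ := δ + σ * Complex.I)
    (by simpa using hδ) (by simpa using hσ)
  simpa [mul_comm] using h2

theorem integral_norm_sq_fourierInv_wavePoisson_le {δ : ℝ} (hδ : 0 < δ) (σ : ℝ) (x : Plane) :
    ∫ y, ‖(𝓕⁻ (wavePoisson hδ σ x)) y‖ ^ 2 ≤ (δ ^ 2)⁻¹ * ∫ ξ : Plane, freq ξ ^ (-4 : ℝ) := by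
  rw [← SchwartzMap.integral_norm_sq_fourier, FourierTransform.fourier_fourierInv_eq,
    ← integral_const_mul]
  refine integral_mono (wavePoisson hδ σ x).integrable_norm_sq
    ((integrable_freq_rpow (by norm_num)).const_mul _) fun ξ => ?_
  have hf := freq_pos ξ
  -- Undamped, the squared symbol is `freq⁻²`, not integrable on the plane. One factor `1/(δ freq)`
  -- taken from the damping improves it to `freq⁻⁴`.
  have h1 : Real.exp (-(δ * freq ξ)) ≤ 1 / (δ * freq ξ) := by
    simpa using exp_neg_le_factorial_div_pow (mul_pos hδ hf) 1
  simp only [wavePoisson_eq, norm_mul, norm_planeWave, one_mul, norm_poissonSymbol]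
  rw [show (-4 : ℝ) = -((4 : ℕ) : ℝ) by norm_num, Real.rpow_neg hf.le, Real.rpow_natCast]
  have h2 : ((δ : ℂ) + σ * Complex.I).re = δ := by simp
  rw [h2]
  calc (Real.exp (-(δ * freq ξ)) / freq ξ) ^ 2 ≤ (1 / (δ * freq ξ) / freq ξ) ^ 2 := by gcongr
    _ = _ := by field_simp

/-- Young's inequality with exponents `8` and `8/7`. For `v = ⟨y⟩⁻²` the last term is `⟨y⟩^(-16/7)`,
integrable because `16/7 > 2`, whereas `⟨y⟩⁻²` itself is not; giving up the power `1/4` of `a` is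
the price. -/
theorem rpow_quarter_mul_le {a v : ℝ} (ha : 0 ≤ a) (hv : 0 ≤ v) :
    a ^ (1 / 4 : ℝ) * v ≤ a ^ 2 + v ^ (8 / 7 : ℝ) := by
  have hconj : Real.HolderConjugate 8 (8 / 7) := by
    rw [Real.holderConjugate_iff]; norm_num
  have h := Real.young_inequality_of_nonneg (Real.rpow_nonneg ha (1 / 4)) hv hconj
  rw [← Real.rpow_mul ha, show (1 / 4 * 8 : ℝ) = ((2 : ℕ) : ℝ) by norm_num, Real.rpow_natCast] at h
  have h1 : 0 ≤ a ^ 2 := sq_nonneg a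
  have h2 : 0 ≤ v ^ (8 / 7 : ℝ) := Real.rpow_nonneg hv _
  linarith

theorem integrable_inv_one_add_norm_sq_rpow :
    Integrable fun y : Plane => ((1 + ‖y‖ ^ 2)⁻¹ : ℝ) ^ (8 / 7 : ℝ) := by
  refine (integrable_rpow_neg_one_add_norm_sq (E := Plane) (μ := volume) (r := 16 / 7)
    (by simp; norm_num)).congr (Filter.Eventually.of_forall fun y => ?_)
  simp only
  rw [Real.inv_rpow (by positivity), ← Real.rpow_neg (by positivity)]
  norm_num

/-- A pointwise bound and an `L²` bound give a weighted `L²` bound. -/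
theorem decayNorm_sq_le (Φ : 𝓢(Plane, ℂ)) {A : ℝ} (hA : ∀ y, ‖Φ y‖ ≤ A) :
    decayNorm Φ ^ 2 ≤ A ^ (7 / 4 : ℝ) *
      ((∫ y, ‖Φ y‖ ^ 2) + ∫ y : Plane, ((1 + ‖y‖ ^ 2)⁻¹ : ℝ) ^ (8 / 7 : ℝ)) := by
  rw [decayNorm, Real.sq_sqrt (integral_nonneg fun y => by positivity),
    ← integral_add Φ.integrable_norm_sq integrable_inv_one_add_norm_sq_rpow,
    ← integral_const_mul]
  refine integral_mono (integrable_norm_sq_mul_inv Φ)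
    ((Φ.integrable_norm_sq.add integrable_inv_one_add_norm_sq_rpow).const_mul _) fun y => ?_
  have h0 := norm_nonneg (Φ y)
  have h1 : ‖Φ y‖ ^ 2 = ‖Φ y‖ ^ (7 / 4 : ℝ) * ‖Φ y‖ ^ (1 / 4 : ℝ) := by
    rw [← Real.rpow_add_of_nonneg h0 (by norm_num) (by norm_num), ← Real.rpow_natCast]
    norm_num
  have h2 : ‖Φ y‖ ^ (7 / 4 : ℝ) ≤ A ^ (7 / 4 : ℝ) := by
    gcongr
    exact hA y
  have h3 := rpow_quarter_mul_le h0 (v := (1 + ‖y‖ ^ 2)⁻¹) (by positivity)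
  calc ‖Φ y‖ ^ 2 * (1 + ‖y‖ ^ 2)⁻¹
      = ‖Φ y‖ ^ (7 / 4 : ℝ) * (‖Φ y‖ ^ (1 / 4 : ℝ) * (1 + ‖y‖ ^ 2)⁻¹) := by rw [h1]; ring
    _ ≤ A ^ (7 / 4 : ℝ) * (‖Φ y‖ ^ 2 + ((1 + ‖y‖ ^ 2)⁻¹ : ℝ) ^ (8 / 7 : ℝ)) := by
        gcongr
        exact Real.rpow_nonneg (h0.trans (hA y)) _

/-- A constant for the weighted bound on the kernel. -/
def decayConst : ℝ :=
  1 + (∫ ξ : Plane, freq ξ ^ (-4 : ℝ)) + ∫ y : Plane, ((1 + ‖y‖ ^ 2)⁻¹ : ℝ) ^ (8 / 7 : ℝ)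

theorem one_le_decayConst : 1 ≤ decayConst := by
  have h1 : 0 ≤ ∫ ξ : Plane, freq ξ ^ (-4 : ℝ) :=
    integral_nonneg fun ξ => Real.rpow_nonneg (freq_pos ξ).le _
  have h2 : 0 ≤ ∫ y : Plane, ((1 + ‖y‖ ^ 2)⁻¹ : ℝ) ^ (8 / 7 : ℝ) :=
    integral_nonneg fun y => Real.rpow_nonneg (by positivity) _
  rw [decayConst]
  linarith

theorem decayNorm_fourierInv_wavePoisson_le {δ : ℝ} (hδ : 0 < δ) {σ : ℝ} (hσ : σ ≠ 0)
    (x : Plane) :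
    decayNorm (𝓕⁻ (wavePoisson hδ σ x)) ≤
      decayConst * (1 + δ⁻¹) * (δ * |σ|) ^ (-(7 / 8) : ℝ) := by
  have hσ' : 0 < |σ| := abs_pos.2 hσ
  have h1 := decayNorm_sq_le _ (norm_fourierInv_wavePoisson_le hδ hσ x)
  have h2 := integral_norm_sq_fourierInv_wavePoisson_le hδ σ x
  have hC := one_le_decayConst
  have hp := Real.rpow_nonneg (mul_pos hδ hσ').le (-(7 / 8))
  refine (pow_le_pow_iff_left₀ (Real.sqrt_nonneg _) (by positivity) two_ne_zero).1 ?_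
  refine h1.trans ?_
  have h3 : ((δ * |σ|)⁻¹) ^ (7 / 4 : ℝ) = ((δ * |σ|) ^ (-(7 / 8) : ℝ)) ^ 2 := by
    rw [← Real.rpow_natCast, ← Real.rpow_mul (by positivity), Real.inv_rpow (by positivity),
      ← Real.rpow_neg (by positivity)]
    norm_num
  rw [h3, mul_pow, mul_comm]
  refine mul_le_mul_of_nonneg_right ?_ (by positivity)
  have hI1 : 0 ≤ ∫ ξ : Plane, freq ξ ^ (-4 : ℝ) :=
    integral_nonneg fun ξ => Real.rpow_nonneg (freq_pos ξ).le _
  have hI2 : 0 ≤ ∫ y : Plane, ((1 + ‖y‖ ^ 2)⁻¹ : ℝ) ^ (8 / 7 : ℝ) :=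
    integral_nonneg fun y => Real.rpow_nonneg (by positivity) _
  have hδi : 0 < δ⁻¹ := by positivity
  rw [← inv_pow] at h2
  have hD : decayConst = 1 + (∫ ξ : Plane, freq ξ ^ (-4 : ℝ)) +
    ∫ y : Plane, ((1 + ‖y‖ ^ 2)⁻¹ : ℝ) ^ (8 / 7 : ℝ) := rfl
  calc _ ≤ decayConst * (1 + δ⁻¹) ^ 2 := by
        rw [hD]
        nlinarith [mul_nonneg hI1 hδi.le, mul_nonneg hI2 hδi.le,
          mul_nonneg hI2 (sq_nonneg δ⁻¹)]
    _ ≤ decayConst ^ 2 * (1 + δ⁻¹) ^ 2 := by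
        gcongr
        nlinarith
    _ = _ := by ring

/-- `freq` is `2π`-Lipschitz: factor the difference of the squares and use `2π‖ζ‖ ≤ freq ζ`. -/
theorem norm_fderiv_freq_le (ξ : Plane) : ‖fderiv ℝ freq ξ‖ ≤ 2 * Real.pi := by
  refine norm_fderiv_le_of_lip' ℝ (by positivity) (Filter.Eventually.of_forall fun η => ?_)
  have h1 := freq_sq ξ
  have h2 := freq_sq η
  have hξ := freq_pos ξ
  have hη := freq_pos η
  have hpi := Real.pi_pos
  have h3 : |‖η‖ - ‖ξ‖| ≤ ‖η - ξ‖ := abs_norm_sub_norm_le η ξ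
  have hb : ∀ ζ : Plane, 2 * Real.pi * ‖ζ‖ ≤ freq ζ := fun ζ =>
    (pow_le_pow_iff_left₀ (by positivity) (freq_pos ζ).le two_ne_zero).1
      (by rw [freq_sq, mul_pow]; linarith)
  have h4 : (freq η - freq ξ) * (freq η + freq ξ) =
      (2 * Real.pi) ^ 2 * ((‖η‖ - ‖ξ‖) * (‖η‖ + ‖ξ‖)) := by nlinarith
  have h5 : |freq η - freq ξ| * (freq η + freq ξ) ≤
      2 * Real.pi * ‖η - ξ‖ * (freq η + freq ξ) := by
    calc |freq η - freq ξ| * (freq η + freq ξ)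
        = |(freq η - freq ξ) * (freq η + freq ξ)| := by
          rw [abs_mul, abs_of_pos (by linarith : 0 < freq η + freq ξ)]
      _ = 2 * Real.pi * |‖η‖ - ‖ξ‖| * (2 * Real.pi * ‖η‖ + 2 * Real.pi * ‖ξ‖) := by
          rw [h4, abs_mul, abs_mul, abs_of_nonneg (by positivity : 0 ≤ ‖η‖ + ‖ξ‖),
            abs_of_pos (by positivity : 0 < (2 * Real.pi) ^ 2)]
          ring
      _ ≤ _ := by
          gcongr
          exacts [hb η, hb ξ]
  rw [Real.norm_eq_abs]
  exact le_of_mul_le_mul_right h5 (by linarith)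

/-- The bound is uniform in `δ` because `δ freq · exp(-δ freq) ≤ 1`. The radial derivative is thus
at most `9 freq^7`, and `‖∇freq‖ ≤ 2π` turns `9` into `18π ≤ 60`. -/
theorem norm_fderiv_exp_smul_bracketSymbol_le {δ : ℝ} (hδ : 0 < δ) {k : ℝ} (hk : 0 ≤ k)
    (hk7 : k ≤ 7) (j : Fin 2) (ξ : Plane) :
    ‖fderiv ℝ (fun ξ => Real.exp (-(δ * freq ξ)) • bracketSymbol (k + 1) ξ) ξ
      (EuclideanSpace.single j (1 : ℝ))‖ ≤ 60 * freq ξ ^ (7 : ℝ) := by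
  have hf := freq_pos ξ
  have hf1 := one_le_freq ξ
  have hd1 : HasFDerivAt freq (fderiv ℝ freq ξ) ξ :=
    (freq_hasTemperateGrowth.1.differentiable (by simp) ξ).hasFDerivAt
  have hM : HasDerivAt (fun r : ℝ => Real.exp (-(δ * r)) * r ^ (k + 1))
      (Real.exp (-(δ * freq ξ)) * (-(δ * 1)) * freq ξ ^ (k + 1) +
        Real.exp (-(δ * freq ξ)) * ((k + 1) * freq ξ ^ (k + 1 - 1))) (freq ξ) :=
    (((hasDerivAt_id' (freq ξ)).const_mul δ).neg.exp).mul
      (Real.hasDerivAt_rpow_const (Or.inl hf.ne'))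
  have hMC := (hM.ofReal_comp.hasFDerivAt).comp ξ hd1
  have hfun : (fun ξ => Real.exp (-(δ * freq ξ)) • bracketSymbol (k + 1) ξ) =
      (fun r : ℝ => ((Real.exp (-(δ * r)) * r ^ (k + 1) : ℝ) : ℂ)) ∘ freq := by
    ext ξ
    simp [bracketSymbol_eq]
  rw [hfun, hMC.fderiv]
  set M' := Real.exp (-(δ * freq ξ)) * (-(δ * 1)) * freq ξ ^ (k + 1) +
        Real.exp (-(δ * freq ξ)) * ((k + 1) * freq ξ ^ (k + 1 - 1)) with hM'
  have hk1 : freq ξ ^ (k + 1) = freq ξ ^ k * freq ξ := by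
    rw [Real.rpow_add hf, Real.rpow_one]
  have hx : δ * freq ξ * Real.exp (-(δ * freq ξ)) ≤ 1 := by
    have h := exp_neg_le_factorial_div_pow (mul_pos hδ hf) 1
    have h' : 0 < δ * freq ξ := by positivity
    calc δ * freq ξ * Real.exp (-(δ * freq ξ)) ≤ δ * freq ξ * (1 / (δ * freq ξ)) := by
          gcongr; simpa using h
      _ = 1 := by field_simp
  have he : Real.exp (-(δ * freq ξ)) ≤ 1 := by
    rw [Real.exp_le_one_iff]
    have : 0 < δ * freq ξ := by positivity
    linarith
  have hfk : 0 ≤ freq ξ ^ k := Real.rpow_nonneg hf.le _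
  have hfk7 : freq ξ ^ k ≤ freq ξ ^ (7 : ℝ) := Real.rpow_le_rpow_of_exponent_le hf1 hk7
  have he0 := Real.exp_pos (-(δ * freq ξ))
  have hbound : |M'| ≤ 9 * freq ξ ^ (7 : ℝ) := by
    have h1 : M' = freq ξ ^ k * (Real.exp (-(δ * freq ξ)) * (k + 1) -
        δ * freq ξ * Real.exp (-(δ * freq ξ))) := by
      rw [hM', hk1, add_sub_cancel_right]
      ring
    have h2 : 0 ≤ δ * freq ξ * Real.exp (-(δ * freq ξ)) := by positivity
    have h3 : |Real.exp (-(δ * freq ξ)) * (k + 1) - δ * freq ξ * Real.exp (-(δ * freq ξ))| ≤ 9 := by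
      rw [abs_le]
      constructor <;> nlinarith
    rw [h1, abs_mul, abs_of_nonneg hfk]
    calc _ ≤ freq ξ ^ (7 : ℝ) * 9 := by gcongr
      _ = _ := mul_comm _ _
  have hv : |fderiv ℝ freq ξ (EuclideanSpace.single j (1 : ℝ))| ≤ 2 * Real.pi := by
    have h := (fderiv ℝ freq ξ).le_opNorm (EuclideanSpace.single j (1 : ℝ))
    rw [Real.norm_eq_abs] at h
    refine h.trans ?_
    rw [PiLp.norm_single]
    simpa using norm_fderiv_freq_le ξ
  have happ : ‖(((ContinuousLinearMap.toSpanSingleton ℝ ((M' : ℝ) : ℂ))).comp (fderiv ℝ freq ξ))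
      (EuclideanSpace.single j (1 : ℝ))‖ ≤ 60 * freq ξ ^ (7 : ℝ) := by
    simp only [ContinuousLinearMap.comp_apply, ContinuousLinearMap.toSpanSingleton_apply,
      norm_smul, Complex.norm_real, Real.norm_eq_abs]
    have h7 : 0 ≤ freq ξ ^ (7 : ℝ) := Real.rpow_nonneg hf.le _
    calc _ ≤ 2 * Real.pi * (9 * freq ξ ^ (7 : ℝ)) := by gcongr
      _ ≤ _ := by nlinarith [Real.pi_lt_d2]
  exact happ

/-- The weak derivative relation between the profile `exp (iσ⟨D⟩)⟨D⟩^{-s}` of `V` on the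
Fourier side and `⟨D⟩^{-5} W_j`. -/
def WeakGradient (s σ : ℝ) (V : Lp Spinor 2 (volume : Measure Plane))
    (W : Fin 2 → Lp Spinor 2 (volume : Measure Plane)) : Prop :=
  ∀ (j : Fin 2) (χ : 𝓢(Plane, ℂ)),
    (2 * Real.pi * Complex.I) • ∫ ξ, (bracketSymbol (-5) ξ * χ ξ) • W j ξ =
      ∫ ξ, (propagatorSymbol σ ξ * bracketSymbol (-s) ξ *
        (∂_{EuclideanSpace.single j (1 : ℝ)} χ) ξ) • V ξ

theorem norm_integral_lowFreq_le {s σ k δ E : ℝ} (hs : 50 ≤ s) (hk : 0 ≤ k) (hk7 : k ≤ 7)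
    (hσ : σ ≠ 0) (hδ : 0 < δ) {V : Lp Spinor 2 (volume : Measure Plane)}
    {W : Fin 2 → Lp Spinor 2 (volume : Measure Plane)} (hVW : WeakGradient s σ V W)
    (hV : ‖V‖ ≤ E) (hW : ∀ j, ‖W j‖ ≤ E) (x : Plane) :
    ‖∫ ξ, (planeWave x ξ * ((Real.exp (-(2 * δ * freq ξ)) * freq ξ ^ (k - s) : ℝ) : ℂ)) • V ξ‖ ≤
      121 * decayConst * ((1 + δ⁻¹ ^ 3) * (1 + δ⁻¹) * (δ * |σ|) ^ (-(7 / 8) : ℝ)) * E := by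
  have hE : 0 ≤ E := (norm_nonneg V).trans hV
  -- The damping `exp(-2δ freq)` is shared equally between `m` and the kernel. The exponent is `k +
  -- 1` because `wavePoisson` contains `freq⁻¹`.
  set m : Plane → ℂ := fun ξ => Real.exp (-(δ * freq ξ)) • bracketSymbol (k + 1) ξ with hm
  have hmt : m.HasTemperateGrowth :=
    (expSchwartz hδ (hasTemperateGrowth_bracketSymbol (k + 1))).hasTemperateGrowth
  have hexp1 : ∀ ξ : Plane, Real.exp (-(δ * freq ξ)) ≤ 1 := fun ξ => by
    rw [Real.exp_le_one_iff]
    have := mul_pos hδ (freq_pos ξ)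
    linarith
  have hnb : ∀ ξ, ‖propagatorSymbol σ ξ * bracketSymbol (-s) ξ‖ = freq ξ ^ (-s) := fun ξ => by
    rw [norm_mul, norm_propagatorSymbol, norm_bracketSymbol, one_mul]
  have hnm : ∀ ξ, ‖m ξ‖ = Real.exp (-(δ * freq ξ)) * freq ξ ^ (k + 1) := fun ξ => by
    rw [hm, norm_smul, norm_bracketSymbol, Real.norm_of_nonneg (Real.exp_nonneg _)]
  have hpow : ∀ ξ, ∀ {r : ℝ}, r ≤ 0 → freq ξ ^ r ≤ 1 := fun ξ r hr =>
    Real.rpow_le_one_of_one_le_of_nonpos (one_le_freq ξ) hr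
  have key := norm_integral_mul_fourier_smul_le
    (b := fun ξ => propagatorSymbol σ ξ * bracketSymbol (-s) ξ)
    (c := bracketSymbol (-5)) (m := m)
    (((hasTemperateGrowth_propagatorSymbol σ).1.continuous.mul
      (hasTemperateGrowth_bracketSymbol (-s)).1.continuous).aestronglyMeasurable)
    (hasTemperateGrowth_bracketSymbol (-5)).1.continuous.aestronglyMeasurable hmt V W hVW
    -- The weighted norm supplies only `freq^(-5)` against `freq^(k+1)`, which may be `freq^8`. The
    -- three missing powers come from `exp(-δ freq) ≤ 3!/(δ freq)^3`, hence `6δ⁻³`.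
    (M₀ := 1) (M₁ := 6 * δ⁻¹ ^ 3) (M₂ := 60) zero_le_one (by positivity) (by norm_num)
    (fun ξ => by rw [hnb]; exact hpow ξ (by linarith)) (fun ξ => by
      rw [norm_mul, hnb, hnm]
      calc freq ξ ^ (-s) * (Real.exp (-(δ * freq ξ)) * freq ξ ^ (k + 1))
          ≤ freq ξ ^ (-s) * (1 * freq ξ ^ (k + 1)) := by
            have := freq_pos ξ
            gcongr
            exact hexp1 ξ
        _ = freq ξ ^ (-s + (k + 1)) := by rw [one_mul, ← Real.rpow_add (freq_pos ξ)]
        _ ≤ 1 := hpow ξ (by linarith))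
    (fun ξ => by
      have hf := freq_pos ξ
      rw [norm_mul, norm_bracketSymbol, hnm]
      calc freq ξ ^ (-5 : ℝ) * (Real.exp (-(δ * freq ξ)) * freq ξ ^ (k + 1))
          ≤ freq ξ ^ (-5 : ℝ) * (((Nat.factorial 3 : ℝ) / (δ * freq ξ) ^ 3) *
              freq ξ ^ (k + 1)) := by
            gcongr
            exact exp_neg_le_factorial_div_pow (mul_pos hδ hf) 3
        _ = 6 * δ⁻¹ ^ 3 * freq ξ ^ (-5 + (k + 1) + -3) := by
            rw [Real.rpow_add hf _ (-3), Real.rpow_add hf (-5),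
              show (-3 : ℝ) = -((3 : ℕ) : ℝ) by norm_num,
              Real.rpow_neg hf.le ((3 : ℕ) : ℝ), Real.rpow_natCast, mul_pow]
            norm_num [Nat.factorial]
            field_simp
        _ ≤ 6 * δ⁻¹ ^ 3 * 1 := by
            gcongr
            exact hpow ξ (by linarith)
        _ = _ := mul_one _)
    (fun j ξ => by
      have hf := freq_pos ξ
      rw [norm_mul, hnb]
      calc _ ≤ freq ξ ^ (-s) * (60 * freq ξ ^ (7 : ℝ)) := by
            gcongr
            exact norm_fderiv_exp_smul_bracketSymbol_le hδ hk hk7 j ξ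
        _ = 60 * freq ξ ^ (-s + 7) := by rw [Real.rpow_add hf]; ring
        _ ≤ 60 * 1 := by
            gcongr
            exact hpow ξ (by linarith)
        _ = 60 := mul_one _)
    hV hW (𝓕⁻ (wavePoisson hδ σ x))
  rw [FourierTransform.fourier_fourierInv_eq] at key
  have hcongr : ∀ ξ, propagatorSymbol σ ξ * bracketSymbol (-s) ξ * m ξ * wavePoisson hδ σ x ξ =
      planeWave x ξ * ((Real.exp (-(2 * δ * freq ξ)) * freq ξ ^ (k - s) : ℝ) : ℂ) := by
    intro ξ
    have h1 : Real.exp (-(2 * δ * freq ξ)) =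
        Real.exp (-(δ * freq ξ)) * Real.exp (-(δ * freq ξ)) := by
      rw [← Real.exp_add]; congr 1; ring
    have h2 : ((freq ξ ^ (k - s) : ℝ) : ℂ) =
        bracketSymbol (-s) ξ * bracketSymbol (k + 1) ξ * bracketSymbol (-1) ξ := by
      rw [bracketSymbol_mul, bracketSymbol_mul, bracketSymbol_eq]
      congr 2
      ring
    rw [wavePoisson_apply, hm, Complex.ofReal_mul, h2, h1, Complex.ofReal_mul]
    simp only [Complex.real_smul]
    linear_combination (bracketSymbol (-s) ξ * bracketSymbol (k + 1) ξ * bracketSymbol (-1) ξ *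
      (Real.exp (-(δ * freq ξ)) : ℂ) * (Real.exp (-(δ * freq ξ)) : ℂ) * planeWave x ξ) *
      propagatorSymbol_mul_neg σ ξ
  simp only [hcongr] at key
  refine key.trans ?_
  have hN := decayNorm_fourierInv_wavePoisson_le hδ hσ x
  have hδ3 : 0 ≤ δ⁻¹ ^ 3 := by positivity
  have hN0 : 0 ≤ decayNorm (𝓕⁻ (wavePoisson hδ σ x)) := Real.sqrt_nonneg _
  -- `121 = 1 + 2 · 60`, which also exceeds the coefficient `12` of `δ⁻³`.
  calc (1 + 2 * (6 * δ⁻¹ ^ 3) + 2 * 60) * decayNorm (𝓕⁻ (wavePoisson hδ σ x)) * E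
      ≤ (121 * (1 + δ⁻¹ ^ 3)) *
        (decayConst * (1 + δ⁻¹) * (δ * |σ|) ^ (-(7 / 8) : ℝ)) * E := by
        gcongr
        linarith
    _ = _ := by ring

end LowFrequency

/-! ### Frequency splitting and the rate `3/4`. -/

section PointwiseDecay

/-- The `L²` norm of `⟨2πξ⟩^{-7}`. -/
def freqTailNorm : ℝ := Real.sqrt (∫ ξ : Plane, (freq ξ ^ (-7 : ℝ)) ^ 2)

theorem memLp_freq_rpow_neg_seven : MemLp (fun ξ : Plane => freq ξ ^ (-7 : ℝ)) 2 volume := by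
  rw [memLp_two_iff_integrable_sq
    (freq_rpow_hasTemperateGrowth (-7)).1.continuous.aestronglyMeasurable]
  refine (integrable_freq_rpow (r := 14) (by norm_num)).congr
    (Filter.Eventually.of_forall fun ξ => ?_)
  simp only
  rw [← Real.rpow_natCast, ← Real.rpow_mul (freq_pos ξ).le]
  norm_num

theorem norm_integral_smul_le_of_le_freq_rpow {f : Plane → ℂ}
    (hf : AEStronglyMeasurable f volume) {M : ℝ} (hM : 0 ≤ M)
    (hfM : ∀ ξ, ‖f ξ‖ ≤ M * freq ξ ^ (-7 : ℝ)) (V : Lp Spinor 2 (volume : Measure Plane)) :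
    (Integrable fun ξ => f ξ • V ξ) ∧ ‖∫ ξ, f ξ • V ξ‖ ≤ M * freqTailNorm * ‖V‖ := by
  have hle : ∀ᵐ ξ : Plane, ‖f ξ‖ ≤ M * ‖freq ξ ^ (-7 : ℝ)‖ :=
    Filter.Eventually.of_forall fun ξ => by
      rw [Real.norm_of_nonneg (Real.rpow_nonneg (freq_pos ξ).le _)]
      exact hfM ξ
  have hmem : MemLp f 2 volume := memLp_freq_rpow_neg_seven.of_le_mul hf hle
  refine ⟨hmem.integrable_smul_Lp_two V, (norm_integral_smul_le hmem V).trans ?_⟩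
  gcongr
  have h := eLpNorm_le_mul_eLpNorm_of_ae_le_mul hle 2
  have h2 := ENNReal.toReal_mono
    (ENNReal.mul_ne_top ENNReal.ofReal_ne_top memLp_freq_rpow_neg_seven.2.ne) h
  rw [ENNReal.toReal_mul, ENNReal.toReal_ofReal hM,
    toReal_eLpNorm_two_eq_sqrt memLp_freq_rpow_neg_seven] at h2
  simp only [Real.norm_eq_abs, sq_abs] at h2
  exact h2

theorem one_eq_one_sub_pow_add_sum (n : ℕ) (z : ℝ) :
    1 = (1 - z) ^ n + ∑ j ∈ Finset.range n, -((-1) ^ (j + 1) * (n.choose (j + 1) : ℝ)) *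
      z ^ (j + 1) := by
  have h := add_pow (-z) 1 n
  rw [Finset.sum_range_succ'] at h
  simp only [one_pow, mul_one, pow_zero, Nat.choose_zero_right, Nat.cast_one] at h
  have h2 : ∑ j ∈ Finset.range n, -((-1) ^ (j + 1) * (n.choose (j + 1) : ℝ)) * z ^ (j + 1) =
      -∑ j ∈ Finset.range n, (-z) ^ (j + 1) * (n.choose (j + 1) : ℝ) := by
    rw [← Finset.sum_neg_distrib]
    refine Finset.sum_congr rfl fun j _ => ?_
    rw [neg_pow z]
    ring
  rw [h2, show 1 - z = -z + 1 by ring, h]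
  ring

/-- With `g = t^(1/48)` one has `δ⁻¹ ≤ 2g`, so the prefactors cost `g^4 = t^(32/384)`, while
`(δt)^(-7/8)` gains `t^(-329/384)`. The total `-297/384` lies below `-3/4 = -288/384`. The left side
decreases in `δ`, so a lower bound on `δ` suffices. -/
theorem lowFreq_rate_le {t δ : ℝ} (ht : 1 ≤ t) (hδ : t ^ (-(1 / 48) : ℝ) / 2 ≤ δ) :
    (1 + δ⁻¹ ^ 3) * (1 + δ⁻¹) * (δ * t) ^ (-(7 / 8) : ℝ) ≤ 54 * t ^ (-(3 / 4) : ℝ) := by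
  have ht0 : 0 < t := by linarith
  set η := t ^ (-(1 / 48) : ℝ) with hη
  have hη0 : 0 < η := Real.rpow_pos_of_pos ht0 _
  have hδ0 : 0 < δ := by linarith
  set g := t ^ (1 / 48 : ℝ) with hg
  have hg1 : 1 ≤ g := Real.one_le_rpow ht (by norm_num)
  have hηg : η = g⁻¹ := by rw [hη, hg, Real.rpow_neg ht0.le]
  have hinv : δ⁻¹ ≤ 2 * g := by
    rw [inv_le_comm₀ hδ0 (by positivity)]
    refine le_trans (le_of_eq ?_) hδ
    rw [hηg]
    field_simp
  have h1 : 1 + δ⁻¹ ^ 3 ≤ 9 * g ^ 3 := by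
    have : δ⁻¹ ^ 3 ≤ (2 * g) ^ 3 := by gcongr
    have h3 : 1 ≤ g ^ 3 := one_le_pow₀ hg1
    nlinarith
  have h2 : 1 + δ⁻¹ ≤ 3 * g := by linarith
  have h3 : (δ * t) ^ (-(7 / 8) : ℝ) ≤ 2 * t ^ (-(329 / 384) : ℝ) := by
    have h4 : (δ * t) ^ (-(7 / 8) : ℝ) ≤ (2⁻¹ * t ^ (47 / 48 : ℝ)) ^ (-(7 / 8) : ℝ) := by
      refine Real.rpow_le_rpow_of_nonpos (by positivity) ?_ (by norm_num)
      have h5 : t ^ (47 / 48 : ℝ) = η * t := by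
        rw [hη, ← Real.rpow_add_one ht0.ne']
        norm_num
      rw [h5, ← mul_assoc]
      gcongr
      linarith
    refine h4.trans ?_
    rw [Real.mul_rpow (by norm_num) (by positivity), ← Real.rpow_mul ht0.le,
      Real.inv_rpow (by norm_num), ← Real.rpow_neg (by norm_num)]
    norm_num
    gcongr
    calc (2 : ℝ) ^ (7 / 8 : ℝ) ≤ 2 ^ (1 : ℝ) :=
          Real.rpow_le_rpow_of_exponent_le (by norm_num) (by norm_num)
      _ = 2 := Real.rpow_one 2
  calc _ ≤ (9 * g ^ 3) * (3 * g) * (2 * t ^ (-(329 / 384) : ℝ)) := by gcongr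
    _ = 54 * (g ^ 4 * t ^ (-(329 / 384) : ℝ)) := by ring
    _ = 54 * t ^ (-(297 / 384) : ℝ) := by
        rw [hg, ← Real.rpow_natCast, ← Real.rpow_mul ht0.le, ← Real.rpow_add ht0]
        norm_num
    _ ≤ _ := by
        gcongr 1
        exact Real.rpow_le_rpow_of_exponent_le ht (by norm_num)

theorem half_mul_rpow_le_japaneseBracket {σ : ℝ} {r : ℝ} (hr : 0 < r)
    (h : japaneseBracket σ ≤ 2 * r) :
    r ^ (-(3 / 4) : ℝ) ≤ 2 * japaneseBracket σ ^ (-(3 / 4) : ℝ) := by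
  have h1 : (2 * r) ^ (-(3 / 4) : ℝ) ≤ japaneseBracket σ ^ (-(3 / 4) : ℝ) :=
    Real.rpow_le_rpow_of_nonpos (japaneseBracket_pos σ) h (by norm_num)
  have h2 : (1 / 2 : ℝ) ≤ 2 ^ (-(3 / 4) : ℝ) := by
    calc (1 / 2 : ℝ) = 2 ^ (-1 : ℝ) := by rw [Real.rpow_neg_one]; norm_num
      _ ≤ _ := Real.rpow_le_rpow_of_exponent_le (by norm_num) (by norm_num)
  rw [Real.mul_rpow (by norm_num) hr.le] at h1
  nlinarith [Real.rpow_pos_of_pos hr (-(3 / 4))]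

/-- The coefficients of `1 - (1 - z) ^ 36`. -/
def cutoffCoeff (j : ℕ) : ℝ := -((-1) ^ (j + 1) * (Nat.choose 36 (j + 1) : ℝ))

/-- The constant in the pointwise decay estimate. -/
def pointwiseConst : ℝ :=
  2 * (1 + freqTailNorm + (∑ j ∈ Finset.range 36, |cutoffCoeff j|) * (121 * decayConst * 54))

theorem freqTailNorm_nonneg : 0 ≤ freqTailNorm := Real.sqrt_nonneg _

theorem pointwiseConst_pos : 0 < pointwiseConst := by
  have h1 := freqTailNorm_nonneg
  have h2 := one_le_decayConst
  have h3 : 0 ≤ ∑ j ∈ Finset.range 36, |cutoffCoeff j| :=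
    Finset.sum_nonneg fun j _ => abs_nonneg _
  rw [pointwiseConst]
  positivity

theorem norm_integral_planeWave_le {s σ k E : ℝ} (hs : 50 ≤ s) (hk : 0 ≤ k) (hk7 : k ≤ 7)
    {V : Lp Spinor 2 (volume : Measure Plane)}
    {W : Fin 2 → Lp Spinor 2 (volume : Measure Plane)} (hVW : WeakGradient s σ V W)
    (hV : ‖V‖ ≤ E) (hW : ∀ j, ‖W j‖ ≤ E) (x : Plane) :
    ‖∫ ξ, (planeWave x ξ * bracketSymbol (k - s) ξ) • V ξ‖ ≤
      pointwiseConst * E * japaneseBracket σ ^ (-(3 / 4) : ℝ) := by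
  have hE : 0 ≤ E := (norm_nonneg V).trans hV
  have hD := one_le_decayConst
  set S : ℝ := ∑ j ∈ Finset.range 36, |cutoffCoeff j| with hS
  have hS0 : 0 ≤ S := Finset.sum_nonneg fun j _ => abs_nonneg _
  have htail := freqTailNorm_nonneg
  have hpc : pointwiseConst = 2 * (1 + freqTailNorm + S * (121 * decayConst * 54)) := rfl
  have hjb : japaneseBracket σ = Real.sqrt (1 + |σ| ^ 2) := by
    rw [japaneseBracket_eq_sqrt, Real.norm_eq_abs]
  rcases lt_or_ge |σ| 1 with hσ | hσ
  -- For `|σ| < 1` no decay is required: `k - s ≤ -7` makes the symbol square integrable.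
  · have h1 := (norm_integral_smul_le_of_le_freq_rpow (M := 1)
      (((continuous_planeWave x).mul
        (hasTemperateGrowth_bracketSymbol (k - s)).1.continuous).aestronglyMeasurable)
      zero_le_one (fun ξ => by
        rw [Pi.mul_apply, norm_mul, norm_planeWave, norm_bracketSymbol]
        gcongr
        · exact one_le_freq ξ
        · linarith) V).2
    have h2 : japaneseBracket σ ≤ 2 * 1 := by
      rw [hjb, Real.sqrt_le_left (by norm_num)]
      nlinarith [abs_nonneg σ]
    have h3 := half_mul_rpow_le_japaneseBracket one_pos h2
    rw [Real.one_rpow] at h3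
    refine h1.trans ?_
    have h4 : freqTailNorm * 2 ≤ pointwiseConst := by
      rw [hpc]
      nlinarith [mul_nonneg hS0 (by positivity : 0 ≤ 121 * decayConst * 54)]
    have h5 : 0 ≤ japaneseBracket σ ^ (-(3 / 4) : ℝ) :=
      Real.rpow_nonneg (japaneseBracket_pos σ).le _
    calc 1 * freqTailNorm * ‖V‖ ≤ freqTailNorm * E * 1 := by
          rw [one_mul, mul_one]; gcongr
      _ ≤ freqTailNorm * E * (2 * japaneseBracket σ ^ (-(3 / 4) : ℝ)) := by gcongr
      _ = freqTailNorm * 2 * E * japaneseBracket σ ^ (-(3 / 4) : ℝ) := by ring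
      _ ≤ _ := by gcongr
  · have hσ0 : 0 < |σ| := by linarith
    have hσne : σ ≠ 0 := abs_pos.1 hσ0
    -- The exponent is fixed by `η^36 = |σ|^(-3/4)`. The power `36` is the largest that `36 + k - s
    -- ≤ -7` allows for every `k ≤ 7` and `s ≥ 50`.
    set η := |σ| ^ (-(1 / 48) : ℝ) with hη
    have hη0 : 0 < η := Real.rpow_pos_of_pos hσ0 _
    -- Chosen so that `z^(j+1) = exp(-2δ_j freq)` for `z = exp(-η freq)`.
    set δ : ℕ → ℝ := fun j => (j + 1) * η / 2 with hδ
    have hδ0 : ∀ j, 0 < δ j := fun j => by simp only [hδ]; positivity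
    have hδη : ∀ j, η / 2 ≤ δ j := fun j => by
      simp only [hδ]
      have : (0 : ℝ) ≤ j := Nat.cast_nonneg j
      nlinarith
    set F : ℕ → Plane → ℂ := fun j ξ => planeWave x ξ *
      ((Real.exp (-(2 * δ j * freq ξ)) * freq ξ ^ (k - s) : ℝ) : ℂ) with hF
    set H : Plane → ℂ := fun ξ => planeWave x ξ *
      (((1 - Real.exp (-(η * freq ξ))) ^ 36 * freq ξ ^ (k - s) : ℝ) : ℂ) with hH
    have hcont : Continuous fun ξ : Plane => freq ξ ^ (k - s) :=
      (freq_rpow_hasTemperateGrowth (k - s)).1.continuous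
    have hFcont : ∀ j, Continuous (F j) := fun j => by simp only [hF]; fun_prop
    have hHcont : Continuous H := by simp only [hH]; fun_prop
    have hsplit : ∀ ξ, planeWave x ξ * bracketSymbol (k - s) ξ =
        H ξ + ∑ j ∈ Finset.range 36, (cutoffCoeff j : ℂ) * F j ξ := by
      intro ξ
      have h1 : 1 = (1 - Real.exp (-(η * freq ξ))) ^ 36 + ∑ j ∈ Finset.range 36,
          cutoffCoeff j * Real.exp (-(η * freq ξ)) ^ (j + 1) :=
        one_eq_one_sub_pow_add_sum 36 (Real.exp (-(η * freq ξ)))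
      have h2 : ∀ j : ℕ, Real.exp (-(η * freq ξ)) ^ (j + 1) =
          Real.exp (-(2 * δ j * freq ξ)) := fun j => by
        rw [← Real.exp_nat_mul]
        congr 1
        simp only [hδ]
        push_cast
        ring
      simp only [h2] at h1
      have h3 : freq ξ ^ (k - s) = (1 - Real.exp (-(η * freq ξ))) ^ 36 * freq ξ ^ (k - s) +
          ∑ j ∈ Finset.range 36, cutoffCoeff j *
            (Real.exp (-(2 * δ j * freq ξ)) * freq ξ ^ (k - s)) := by
        simp only [← mul_assoc, ← Finset.sum_mul, ← add_mul]
        rw [← h1, one_mul]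
      rw [bracketSymbol_eq, h3, Complex.ofReal_add, mul_add, Complex.ofReal_sum, Finset.mul_sum]
      congr 1
      refine Finset.sum_congr rfl fun j _ => ?_
      simp only [hF, Complex.ofReal_mul]
      ring
    obtain ⟨hHint, hHle⟩ := norm_integral_smul_le_of_le_freq_rpow (M := |σ| ^ (-(3 / 4) : ℝ))
      hHcont.aestronglyMeasurable (by positivity) (fun ξ => by
        have hf := freq_pos ξ
        have h1 : 0 ≤ 1 - Real.exp (-(η * freq ξ)) := by
          rw [sub_nonneg, Real.exp_le_one_iff]
          have := mul_pos hη0 hf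
          linarith
        have h2 : 1 - Real.exp (-(η * freq ξ)) ≤ η * freq ξ := by
          linarith [Real.add_one_le_exp (-(η * freq ξ))]
        have h3 : η ^ 36 = |σ| ^ (-(3 / 4) : ℝ) := by
          rw [hη, ← Real.rpow_natCast, ← Real.rpow_mul hσ0.le]
          norm_num
        have h4 : 0 ≤ freq ξ ^ (k - s) := Real.rpow_nonneg hf.le _
        simp only [hH]
        rw [norm_mul, norm_planeWave, one_mul, Complex.norm_real,
          Real.norm_of_nonneg (by positivity)]
        calc (1 - Real.exp (-(η * freq ξ))) ^ 36 * freq ξ ^ (k - s)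
            ≤ (η * freq ξ) ^ 36 * freq ξ ^ (k - s) := by gcongr
          _ = |σ| ^ (-(3 / 4) : ℝ) * freq ξ ^ (36 + (k - s)) := by
              rw [mul_pow, h3, Real.rpow_add hf, mul_assoc]
              norm_num
          _ ≤ _ := by
              refine mul_le_mul_of_nonneg_left ?_ (by positivity)
              exact Real.rpow_le_rpow_of_exponent_le (one_le_freq ξ) (by linarith)) V
    have hFint : ∀ j, Integrable fun ξ => F j ξ • V ξ := fun j =>
      (norm_integral_smul_le_of_le_freq_rpow (M := 1) (hFcont j).aestronglyMeasurable zero_le_one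
        (fun ξ => by
          have hf := freq_pos ξ
          simp only [hF, norm_mul, norm_planeWave, one_mul, Complex.norm_real, Real.norm_eq_abs,
            Real.abs_exp]
          rw [abs_of_nonneg (Real.rpow_nonneg hf.le _)]
          have h1 : Real.exp (-(2 * δ j * freq ξ)) ≤ 1 := by
            rw [Real.exp_le_one_iff]
            have := mul_pos (hδ0 j) hf
            linarith
          have h2 : freq ξ ^ (k - s) ≤ freq ξ ^ (-7 : ℝ) :=
            Real.rpow_le_rpow_of_exponent_le (one_le_freq ξ) (by linarith)
          calc _ ≤ 1 * freq ξ ^ (-7 : ℝ) := by gcongr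
            _ = _ := one_mul _) V).1
    have hFle : ∀ j, ‖∫ ξ, F j ξ • V ξ‖ ≤
        121 * decayConst * (54 * |σ| ^ (-(3 / 4) : ℝ)) * E := fun j => by
      refine (norm_integral_lowFreq_le hs hk hk7 hσne (hδ0 j) hVW hV hW x).trans ?_
      refine mul_le_mul_of_nonneg_right (mul_le_mul_of_nonneg_left ?_ (by positivity)) hE
      exact lowFreq_rate_le hσ (hδη j)
    have hval : ∫ ξ, (planeWave x ξ * bracketSymbol (k - s) ξ) • V ξ =
        (∫ ξ, H ξ • V ξ) + ∑ j ∈ Finset.range 36, (cutoffCoeff j : ℂ) • ∫ ξ, F j ξ • V ξ := by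
      simp only [hsplit, add_smul, Finset.sum_smul, mul_smul]
      have hint : ∀ j, Integrable fun ξ => (cutoffCoeff j : ℂ) • F j ξ • V ξ :=
        fun j => (hFint j).smul (cutoffCoeff j : ℂ)
      rw [integral_add hHint (integrable_finsetSum _ fun j _ => hint j),
        integral_finsetSum _ fun j _ => hint j]
      simp only [integral_smul]
    have hrate := half_mul_rpow_le_japaneseBracket hσ0 (σ := σ) (by
      rw [hjb, Real.sqrt_le_left (by positivity)]
      nlinarith)
    have hp := Real.rpow_pos_of_pos hσ0 (-(3 / 4))
    rw [hval]
    refine (norm_add_le _ _).trans ?_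
    have hsum : ‖∑ j ∈ Finset.range 36, (cutoffCoeff j : ℂ) • ∫ ξ, F j ξ • V ξ‖ ≤
        S * (121 * decayConst * (54 * |σ| ^ (-(3 / 4) : ℝ)) * E) := by
      refine (norm_sum_le _ _).trans ?_
      rw [hS, Finset.sum_mul]
      refine Finset.sum_le_sum fun j _ => ?_
      rw [norm_smul, Complex.norm_real, Real.norm_eq_abs]
      gcongr
      exact hFle j
    calc ‖∫ ξ, H ξ • V ξ‖ + ‖∑ j ∈ Finset.range 36, (cutoffCoeff j : ℂ) • ∫ ξ, F j ξ • V ξ‖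
        ≤ |σ| ^ (-(3 / 4) : ℝ) * freqTailNorm * E +
          S * (121 * decayConst * (54 * |σ| ^ (-(3 / 4) : ℝ)) * E) := by
          gcongr
          exact hHle.trans (by gcongr)
      _ = (freqTailNorm + S * (121 * decayConst * 54)) * E * |σ| ^ (-(3 / 4) : ℝ) := by ring
      _ ≤ (1 + freqTailNorm + S * (121 * decayConst * 54)) * E *
          (2 * japaneseBracket σ ^ (-(3 / 4) : ℝ)) := by
          gcongr
          linarith
      _ = _ := by rw [hpc]; ring

end PointwiseDecay

/-! ### From tempered distributions to continuous functions and back to norms. -/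

section Distributions

theorem fourier_fourierMultiplierCLM (g : Plane → ℂ) (u : 𝓢'(Plane, Spinor)) :
    𝓕 (fourierMultiplierCLM Spinor g u) = smulLeftCLM Spinor g (𝓕 u) := by
  rw [TemperedDistribution.fourierMultiplierCLM_apply, FourierTransform.fourier_fourierInv_eq]

theorem smulLeftCLM_bracketSymbol_neg (s : ℝ) (χ : 𝓢(Plane, ℂ)) :
    SchwartzMap.smulLeftCLM ℂ (bracketSymbol s)
      (SchwartzMap.smulLeftCLM ℂ (bracketSymbol (-s)) χ) = χ := by
  ext ξ
  rw [SchwartzMap.smulLeftCLM_apply_apply (hasTemperateGrowth_bracketSymbol s),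
    SchwartzMap.smulLeftCLM_apply_apply (hasTemperateGrowth_bracketSymbol (-s)), smul_smul,
    bracketSymbol_mul, add_neg_cancel, bracketSymbol_eq, Real.rpow_zero]
  simp

theorem fourier_apply_of_bracketD_eq {s : ℝ} {u : 𝓢'(Plane, Spinor)}
    {v : Lp Spinor 2 (volume : Measure Plane)} (h : bracketD s u = (v : 𝓢'(Plane, Spinor)))
    (χ : 𝓢(Plane, ℂ)) :
    (𝓕 u) χ = ∫ ξ, (bracketSymbol (-s) ξ * χ ξ) •
      (𝓕 v : Lp Spinor 2 (volume : Measure Plane)) ξ := by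
  have h1 : smulLeftCLM Spinor (bracketSymbol s) (𝓕 u) =
      ((𝓕 v : Lp Spinor 2 (volume : Measure Plane)) : 𝓢'(Plane, Spinor)) := by
    rw [← Lp.fourier_toTemperedDistribution_eq, ← h, bracketD, fourier_fourierMultiplierCLM]
  have h2 := congrArg
    (fun T : 𝓢'(Plane, Spinor) => T (SchwartzMap.smulLeftCLM ℂ (bracketSymbol (-s)) χ)) h1
  simp only [TemperedDistribution.smulLeftCLM_apply_apply, smulLeftCLM_bracketSymbol_neg,
    Lp.toTemperedDistribution_apply,
    SchwartzMap.smulLeftCLM_apply_apply (hasTemperateGrowth_bracketSymbol (-s)), smul_eq_mul] at h2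
  exact h2

/-- Multiplication by `x_j` in space is a derivative in frequency. Both sides are the profile
`kgPropagator σ u` tested against `2πi x_j 𝓕χ = 𝓕(∂_j χ)`: one expressed through `w j`, the other
through `v`. -/
theorem weakGradient_of_bracketD_eq {s σ : ℝ} {u : 𝓢'(Plane, Spinor)}
    {v : Lp Spinor 2 (volume : Measure Plane)} {w : Fin 2 → Lp Spinor 2 (volume : Measure Plane)}
    (hv : bracketD s u = (v : 𝓢'(Plane, Spinor)))
    (hw : ∀ j, bracketD 5 (mulCoord j (kgPropagator σ u)) = (w j : 𝓢'(Plane, Spinor))) :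
    WeakGradient s σ (𝓕 v) (fun j => 𝓕 (w j)) := by
  intro j χ
  have h1 := fourier_apply_of_bracketD_eq (hw j) χ
  rw [← h1]
  have h2 : (𝓕 (mulCoord j (kgPropagator σ u))) χ =
      (kgPropagator σ u) (SchwartzMap.smulLeftCLM ℂ (coordC j) (𝓕 χ)) := rfl
  have h3 : (𝓕 (kgPropagator σ u)) (∂_{EuclideanSpace.single j (1 : ℝ)} χ) =
      (kgPropagator σ u) (𝓕 (∂_{EuclideanSpace.single j (1 : ℝ)} χ)) := rfl
  rw [h2, ← map_smul, ← fourier_lineDeriv_single, ← h3, kgPropagator,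
    fourier_fourierMultiplierCLM, TemperedDistribution.smulLeftCLM_apply_apply,
    fourier_apply_of_bracketD_eq hv]
  refine integral_congr_ae (Filter.Eventually.of_forall fun ξ => ?_)
  simp only [SchwartzMap.smulLeftCLM_apply_apply (hasTemperateGrowth_propagatorSymbol σ),
    smul_eq_mul]
  congr 1
  ring

/-- The multiplication formula for the Fourier transform, after the reflection `ξ ↦ -ξ`. -/
theorem integral_fourierInv_smul_eq_integral_smul_fourierInv (φ : 𝓢(Plane, ℂ)) {h : Plane → Spinor}
    (hh : Integrable h) : ∫ ξ, (𝓕⁻ φ) ξ • h ξ = ∫ x, φ x • 𝓕⁻ h x := by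
  have h1 := VectorFourier.integral_fourierIntegral_smul_eq_flip (L := innerₗ Plane)
    (f := φ) (g := fun ξ => h (-ξ)) (μ := volume) (ν := volume) Real.continuous_fourierChar
    continuous_inner φ.integrable hh.comp_neg
  have h2 : ∫ ξ, (𝓕⁻ φ) ξ • h ξ = ∫ ξ, (𝓕 (φ : Plane → ℂ)) ξ • h (-ξ) := by
    rw [← integral_neg_eq_self]
    refine integral_congr_ae (Filter.Eventually.of_forall fun ξ => ?_)
    simp only [SchwartzMap.fourierInv_coe, Real.fourierInv_eq_fourier_neg, neg_neg]
  rw [h2]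
  refine Eq.trans h1 ?_
  rw [flip_innerₗ]
  simp only [Real.fourierInv_eq_fourier_comp_neg]
  rfl

theorem continuous_fourierInv_of_integrable {h : Plane → Spinor} (hh : Integrable h) :
    Continuous (𝓕⁻ h) := by
  rw [Real.fourierInv_eq_fourier_comp_neg]
  exact VectorFourier.fourierIntegral_continuous (L := innerₗ Plane) Real.continuous_fourierChar
    continuous_inner hh.comp_neg

/-- A distribution in the weighted space is, after `⟨D⟩^k`, a continuous function with the pointwise
decay. -/
theorem exists_continuous_eq_bracketD {s σ k E : ℝ} (hs : 50 ≤ s) (hk : 0 ≤ k) (hk7 : k ≤ 7)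
    {u : 𝓢'(Plane, Spinor)} {v : Lp Spinor 2 (volume : Measure Plane)}
    {w : Fin 2 → Lp Spinor 2 (volume : Measure Plane)}
    (hv : bracketD s u = (v : 𝓢'(Plane, Spinor)))
    (hw : ∀ j, bracketD 5 (mulCoord j (kgPropagator σ u)) = (w j : 𝓢'(Plane, Spinor)))
    (hvE : ‖v‖ ≤ E) (hwE : ∀ j, ‖w j‖ ≤ E) :
    ∃ Q : Plane → Spinor, Continuous Q ∧
      (∀ x, ‖Q x‖ ≤ pointwiseConst * E * japaneseBracket σ ^ (-(3 / 4) : ℝ)) ∧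
      ∀ φ : 𝓢(Plane, ℂ), (bracketD k u) φ = ∫ x, φ x • Q x := by
  set V : Lp Spinor 2 (volume : Measure Plane) := 𝓕 v with hV
  have hint : Integrable fun ξ => bracketSymbol (k - s) ξ • V ξ :=
    (norm_integral_smul_le_of_le_freq_rpow (M := 1)
      (hasTemperateGrowth_bracketSymbol (k - s)).1.continuous.aestronglyMeasurable zero_le_one
      (fun ξ => by
        rw [norm_bracketSymbol, one_mul]
        exact Real.rpow_le_rpow_of_exponent_le (one_le_freq ξ) (by linarith)) V).1
  refine ⟨𝓕⁻ fun ξ => bracketSymbol (k - s) ξ • V ξ, continuous_fourierInv_of_integrable hint,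
    fun x => ?_, fun φ => ?_⟩
  · have h := norm_integral_planeWave_le (E := E) (V := V) (W := fun j => 𝓕 (w j)) hs hk hk7
      (weakGradient_of_bracketD_eq hv hw) (by rw [hV, Lp.norm_fourier_eq]; exact hvE)
      (fun j => by rw [Lp.norm_fourier_eq]; exact hwE j) x
    rw [Real.fourierInv_eq]
    simpa only [planeWave, mul_smul, Circle.smul_def] using h
  · rw [← integral_fourierInv_smul_eq_integral_smul_fourierInv φ hint]
    have h1 : (bracketD k u) φ =
        (𝓕 u) (SchwartzMap.smulLeftCLM ℂ (bracketSymbol k) (𝓕⁻ φ)) := rfl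
    rw [h1, fourier_apply_of_bracketD_eq hv]
    refine integral_congr_ae (Filter.Eventually.of_forall fun ξ => ?_)
    simp only [SchwartzMap.smulLeftCLM_apply_apply (hasTemperateGrowth_bracketSymbol k),
      smul_eq_mul, smul_smul]
    congr 1
    rw [show k - s = -s + k by ring, ← bracketSymbol_mul]
    ring

theorem exists_of_sobolevNorm_lt {s : ℝ} {p : ℝ≥0∞} [Fact (1 ≤ p)] {u : 𝓢'(Plane, Spinor)} {E : ℝ}
    (h : sobolevNorm s p u < ENNReal.ofReal E) :
    ∃ v : Lp Spinor p (volume : Measure Plane),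
      bracketD s u = (v : 𝓢'(Plane, Spinor)) ∧ ‖v‖ ≤ E := by
  rw [sobolevNorm, iInf_lt_iff] at h
  obtain ⟨v, hv⟩ := h
  rw [iInf_lt_iff] at hv
  obtain ⟨hv1, hv2⟩ := hv
  refine ⟨v, hv1, ?_⟩
  rw [← ofReal_norm] at hv2
  exact (ENNReal.ofReal_lt_ofReal_iff'.1 hv2).1.le

theorem sobolevNorm_top_le {k B : ℝ} {u : 𝓢'(Plane, Spinor)} {Q : Plane → Spinor}
    (hQ : Continuous Q) (hB : ∀ x, ‖Q x‖ ≤ B)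
    (hrep : ∀ φ : 𝓢(Plane, ℂ), (bracketD k u) φ = ∫ x, φ x • Q x) :
    sobolevNorm k ∞ u ≤ ENNReal.ofReal B := by
  have hmem : MemLp Q ∞ volume :=
    memLp_top_of_bound hQ.aestronglyMeasurable B (Filter.Eventually.of_forall hB)
  have heq : bracketD k u = ((hmem.toLp Q : Lp Spinor ∞ (volume : Measure Plane)) :
      𝓢'(Plane, Spinor)) := by
    ext1 φ
    rw [hrep, Lp.toTemperedDistribution_apply]
    refine integral_congr_ae ?_
    filter_upwards [hmem.coeFn_toLp] with x hx
    rw [hx]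
  refine (iInf₂_le (hmem.toLp Q) heq).trans ?_
  rw [Lp.enorm_toLp, eLpNorm_exponent_top]
  exact eLpNormEssSup_le_of_ae_bound (Filter.Eventually.of_forall hB)

theorem diracProj_add_diracProj_neg (u : 𝓢'(Plane, Spinor)) :
    diracProj 1 u + diracProj (-1) u = u := by
  simp only [diracProj, Complex.ofReal_neg, Complex.ofReal_one]
  module

theorem sobolevNorm_mulCoord_le (r : ℝ) (u : 𝓢'(Plane, Spinor)) (j : Fin 2) :
    sobolevNorm r 2 (mulCoord j u) ≤ weightedSobolevNorm r u := by
  have h1 : sobolevNorm r 2 (mulCoord j u) ^ 2 ≤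
      ∑ j : Fin 2, sobolevNorm r 2 (mulCoord j u) ^ 2 :=
    Finset.single_le_sum (f := fun j => sobolevNorm r 2 (mulCoord j u) ^ 2)
      (fun _ _ => zero_le) (Finset.mem_univ j)
  have h2 := ENNReal.rpow_le_rpow h1 (z := 1 / 2) (by norm_num)
  refine le_trans (le_of_eq ?_) h2
  rw [← ENNReal.rpow_natCast, ← ENNReal.rpow_mul]
  norm_num

theorem exists_continuous_of_signedSigmaNorm_le {s θ T k E : ℝ} (hs : 50 ≤ s) (hk : 0 ≤ k)
    (hk7 : k ≤ 7) (hθ : |θ| = 1) {ψ : ℝ → 𝓢'(Plane, Spinor)} (hE : 0 < E)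
    (h : signedSigmaNorm s θ T ψ ≤ ENNReal.ofReal E) {t : ℝ} (ht : t ∈ Set.Icc (0 : ℝ) T) :
    ∃ Q : Plane → Spinor, Continuous Q ∧
      (∀ x, ‖Q x‖ ≤ pointwiseConst * (2 * E) * japaneseBracket t ^ (-(3 / 4) : ℝ)) ∧
      ∀ φ : 𝓢(Plane, ℂ), (bracketD k (ψ t)) φ = ∫ x, φ x • Q x := by
  have h1 : sobolevNorm s 2 (ψ t) + weightedSobolevNorm 5 (kgPropagator (θ * t) (ψ t)) ≤
      ENNReal.ofReal E := (le_iSup₂_of_le (f := fun t (_ : t ∈ Set.Icc (0 : ℝ) T) =>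
        sobolevNorm s 2 (ψ t) + weightedSobolevNorm 5 (kgPropagator (θ * t) (ψ t)))
        t ht le_rfl).trans h
  -- `sobolevNorm` is an infimum, so a representative is extracted from a strict inequality;
  -- doubling `E > 0` provides it.
  have h2 : ENNReal.ofReal E < ENNReal.ofReal (2 * E) :=
    (ENNReal.ofReal_lt_ofReal_iff (by positivity)).2 (by linarith)
  obtain ⟨v, hv, hvE⟩ := exists_of_sobolevNorm_lt ((le_self_add.trans h1).trans_lt h2)
  have h3 := fun j => exists_of_sobolevNorm_lt
    (((sobolevNorm_mulCoord_le 5 _ j).trans (le_add_self.trans h1)).trans_lt h2)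
  choose w hw hwE using h3
  have h4 := exists_continuous_eq_bracketD hs hk hk7 hv hw hvE hwE
  have h5 : japaneseBracket (θ * t) = japaneseBracket t := by
    rw [japaneseBracket, japaneseBracket, norm_mul, Real.norm_eq_abs θ, hθ, one_mul]
  rwa [h5] at h4

end Distributions

end

/-! ### The decay estimate for the full spinor. -/

theorem mainTheorem3 (s : ℝ) (hs : 50 ≤ s) (K : ℝ) (hK : 0 < K) :
    ∃ C : ℝ, 0 < C ∧
      ∀ (T : ℝ) (_ : 0 ≤ T) (ε₁ : ℝ) (_ : 0 < ε₁) (ψ : ℝ → 𝓢'(Plane, Spinor)),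
        sigmaNorm s T ψ ≤ ENNReal.ofReal (K * ε₁) →
        ∀ k ∈ Set.Icc (0 : ℝ) 7, ∀ t ∈ Set.Icc (0 : ℝ) T,
          sobolevNorm k ∞ (ψ t) ≤
            ENNReal.ofReal (C * ε₁ * japaneseBracket t ^ (-(3 / 4) : ℝ)) := by
  -- One factor `2` for the two signs, another for the doubling of `E` in
  -- `exists_continuous_of_signedSigmaNorm_le`.
  refine ⟨4 * pointwiseConst * K, by have := pointwiseConst_pos; positivity, ?_⟩
  intro T _ ε₁ hε ψ hψ k hk t ht
  have hE : 0 < K * ε₁ := mul_pos hK hε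
  obtain ⟨Q₁, hc₁, hb₁, hr₁⟩ := exists_continuous_of_signedSigmaNorm_le hs hk.1 hk.2
    (by norm_num) hE (le_self_add.trans hψ) ht
  obtain ⟨Q₂, hc₂, hb₂, hr₂⟩ := exists_continuous_of_signedSigmaNorm_le hs hk.1 hk.2
    (by norm_num) hE (le_add_self.trans hψ) ht
  have hint : ∀ {Q : Plane → Spinor} {B : ℝ}, Continuous Q → (∀ x, ‖Q x‖ ≤ B) →
      ∀ φ : 𝓢(Plane, ℂ), Integrable fun x => φ x • Q x := fun hQ hB φ =>
    φ.integrable.smul_bdd _ hQ.aestronglyMeasurable (Filter.Eventually.of_forall hB)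
  refine sobolevNorm_top_le (Q := fun x => Q₁ x + Q₂ x) (hc₁.add hc₂) (fun x => ?_) fun φ => ?_
  · refine (norm_add_le _ _).trans ((add_le_add (hb₁ x) (hb₂ x)).trans (le_of_eq ?_))
    ring
  · conv_lhs => rw [← diracProj_add_diracProj_neg (ψ t)]
    simp only [smul_add]
    rw [integral_add (hint hc₁ hb₁ φ) (hint hc₂ hb₂ φ), ← hr₁, ← hr₂, map_add]
    rfl
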